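/- Let $d\ge 1$ and let $\mathbb{S}^{d}\subset\mathbb{R}^{d+1}$ be the unit sphere with surface measure $\sigma$ and geodesic distance $d(u,v)=\arccos\langle u,v\rangle$. For $L\ge 0$ let $\Pi_L$ be the complex vector space of spherical harmonics of degree at most $L$, i.e. the linear span of the restrictions to $\mathbb{S}^d$ of the homogeneous harmonic polynomials on $\mathbb{R}^{d+1}$ with complex coefficients and degree $\ell\le L$, and let $\pi_L=\dim \Pi_L$. A triangular family $\mathcal Z=\{\mathcal Z(L)\}_{L\ge 0}$ consists, for each $L\ge 0$, of points $z_{Lj}\in\mathbb{S}^d$, $1\le j\le m_L$ (repetitions allowed), where $m_L\to\infty$ as $L\to\infty$. It is uniformly separated if there is $\varepsilon>0$ such that $d(z_{Lj},z_{Lk})\ge \varepsilon/(L+1)$ for all $L\ge 0$ and all $j\ne k$. Let $1\le p\le\infty$. The triangular family $\mathcal Z$ is called an $L^p$-Marcinkiewicz–Zygmund ($L^p$-MZ) family if $m_L\ge\pi_L$ for all $L\ge 0$ and there is a constant $C>0$ such that for all $L\ge 0$ and all $Q\in\Pi_L$ $$\frac{C^{-1}}{\pi_L}\sum_{j=1}^{m_L}|Q(z_{Lj})|^p\le\int_{\mathbb{S}^d}|Q(\omega)|^p\,d\sigma(\omega)\le\frac{C}{\pi_L}\sum_{j=1}^{m_L}|Q(z_{Lj})|^p$$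 if $p<\infty$, and $$\sup_{\omega\in\mathbb{S}^d}|Q(\omega)|\le C\sup_{1\le j\le m_L}|Q(z_{Lj})|$$ if $p=\infty$. **Theorem.** Let $d\ge 1$, $1\le p\le\infty$, and let $\mathcal Z$ be an $L^p$-MZ family in $\mathbb{S}^d$. Then there is a triangular family $\tilde{\mathcal Z}\subset\mathcal Z$ (that is, for every $L$, the points of $\tilde{\mathcal Z}(L)$ are the points $z_{Lj}$ of $\mathcal Z(L)$ with $j$ in some subset of $\{1,\dots,m_L\}$) which is uniformly separated and is also an $L^p$-MZ family. -/

import Mathlib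

open MeasureTheory Filter
open scoped ENNReal

noncomputable section

namespace SphereMZ

/-- The unit sphere `𝕊^d` of `ℝ^{d+1}`. -/
abbrev Sph (d : ℕ) : Type :=
  Metric.sphere (0 : EuclideanSpace ℝ (Fin (d + 1))) 1

/-- The (unnormalized) Lebesgue surface measure on `𝕊^d`. -/
def surfaceMeasure (d : ℕ) : Measure (Sph d) :=
  (volume : Measure (EuclideanSpace ℝ (Fin (d + 1)))).toSphere

/-- The geodesic distance `arccos ⟨u, v⟩` on `𝕊^d`. -/
def geodesicDist {d : ℕ} (u v : Sph d) : ℝ :=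
  Real.arccos (inner ℝ (u : EuclideanSpace ℝ (Fin (d + 1))) (v : EuclideanSpace ℝ (Fin (d + 1))))

/-- The Laplacian `∑ᵢ ∂²/∂xᵢ²` on complex polynomials in `d + 1` variables. -/
def polyLaplacian (d : ℕ) :
    MvPolynomial (Fin (d + 1)) ℂ →ₗ[ℂ] MvPolynomial (Fin (d + 1)) ℂ :=
  ∑ i : Fin (d + 1),
    ((MvPolynomial.pderiv i).toLinearMap ∘ₗ (MvPolynomial.pderiv i).toLinearMap)

/-- The restriction of a polynomial in `d + 1` variables to the sphere `𝕊^d`. -/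
def restrictToSphere (d : ℕ) : MvPolynomial (Fin (d + 1)) ℂ →ₗ[ℂ] (Sph d → ℂ) :=
  LinearMap.pi fun x =>
    (MvPolynomial.aeval fun i => (((x : EuclideanSpace ℝ (Fin (d + 1))) i : ℝ) : ℂ)).toLinearMap

/-- `ℋ_ℓ`: the restrictions to `𝕊^d` of the homogeneous harmonic polynomials of degree `ℓ`. -/
def sphericalHarmonics (d ℓ : ℕ) : Submodule ℂ (Sph d → ℂ) :=
  (MvPolynomial.homogeneousSubmodule (Fin (d + 1)) ℂ ℓ ⊓ LinearMap.ker (polyLaplacian d)).map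
    (restrictToSphere d)

/-- `Π_L`: the space of spherical harmonics of degree not exceeding `L`, that is, the sum of the
spaces `ℋ_ℓ` for `0 ≤ ℓ ≤ L`. -/
def harmonicsUpTo (d L : ℕ) : Submodule ℂ (Sph d → ℂ) :=
  ⨆ (ℓ : ℕ) (_ : ℓ ≤ L), sphericalHarmonics d ℓ

/-- `π_L = dim Π_L`. -/
def dimUpTo (d L : ℕ) : ℕ :=
  Module.finrank ℂ (harmonicsUpTo d L)

/-- A triangular family of points in `𝕊^d`: for each degree `L ≥ 0`, points `z_{L,j}`,
`1 ≤ j ≤ m_L` (possibly with repetitions), where `m_L → ∞`. -/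
structure TriangularFamily (d : ℕ) where
  /-- The number of points of generation `L`. -/
  m : ℕ → ℕ
  /-- The points of generation `L`. -/
  point : (L : ℕ) → Fin (m L) → Sph d
  tendsto_m : Tendsto m atTop atTop

namespace TriangularFamily

variable {d : ℕ}

/-- `Z'` is a subfamily of `Z`: in each generation, the points of `Z'` are those of `Z` at some
selection of pairwise distinct indices. -/
def IsSubfamily (Z' Z : TriangularFamily d) : Prop :=
  ∀ L : ℕ, ∃ k : Fin (Z'.m L) ↪ Fin (Z.m L), ∀ j, Z'.point L j = Z.point L (k j)

/-- Uniform separation: `d(z_{L,j}, z_{L,k}) ≥ ε / (L + 1)` for `j ≠ k`, with `ε > 0`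
independent of `L`. -/
def UniformlySeparated (Z : TriangularFamily d) : Prop :=
  ∃ ε : ℝ, 0 < ε ∧ ∀ L : ℕ, ∀ j k : Fin (Z.m L), j ≠ k →
    ε / ((L : ℝ) + 1) ≤ geodesicDist (Z.point L j) (Z.point L k)

/-- `Z` is an `L^p`-Marcinkiewicz-Zygmund family (`1 ≤ p ≤ ∞`). -/
def IsMZ (p : ℝ≥0∞) (Z : TriangularFamily d) : Prop :=
  (∀ L : ℕ, dimUpTo d L ≤ Z.m L) ∧
  (p ≠ ∞ → ∃ C : ℝ, 0 < C ∧ ∀ L : ℕ, ∀ Q ∈ harmonicsUpTo d L,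
    C⁻¹ / (dimUpTo d L : ℝ) * ∑ j, ‖Q (Z.point L j)‖ ^ p.toReal
        ≤ ∫ ω, ‖Q ω‖ ^ p.toReal ∂(surfaceMeasure d) ∧
    ∫ ω, ‖Q ω‖ ^ p.toReal ∂(surfaceMeasure d)
        ≤ C / (dimUpTo d L : ℝ) * ∑ j, ‖Q (Z.point L j)‖ ^ p.toReal) ∧
  (p = ∞ → ∃ C : ℝ, 0 < C ∧ ∀ L : ℕ, ∀ Q ∈ harmonicsUpTo d L,
    ⨆ ω, ‖Q ω‖ ≤ C * ⨆ j, ‖Q (Z.point L j)‖)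

end TriangularFamily

end SphereMZ

end

/-! In each generation select a maximal set of points at mutual distance at least ε/(L+1), so that
every point z_j has a selected neighbour within that distance. Two facts show that the selected
points still sample Π_L well.

Perturbation. If x and y are that close, then |f(y) - f(x)| ≤ Σ |g_i(x)| with g_i in Π_L and Σ
‖g_i‖_p ≤ η ‖f‖_p, where η is as small as desired if ε is small (`exists_controlled_close`). The g_i
are evaluated at the old points, so the given inequalities apply to them: replacing every z_j by its
neighbour costs a small multiple of ‖f‖_p, which the lower bound absorbs. The g_i come from Taylor
expansion along rotations of coordinate planes. Up to a factor ζ^L, f along the rotation by ζ is a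
polynomial in ζ of degree at most 2L with coefficients in Π_L, and its L^p norm is constant on the
circle; the maximum principle and Cauchy's estimate then give a Bernstein inequality
(`controlled_smallRot`). Close points are joined by d such rotations (`exists_controlled_pivot`).

Multiplicity. For p < ∞ one selected point could replace many old ones. Testing on the squared
reproducing kernel of degree L/2 at that point (`exists_concentrated`) bounds their number; this
needs π_L ≤ C π_{L/2}. Hence the sum with repetitions is at most a constant times the sum over
selected points.

The resulting lower inequality makes sampling at the selected points injective on Π_L, so there are
at least π_L of them. -/

namespace SphereMZ

variable {d : ℕ}

section Polynomials

open MvPolynomial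

/-! ### Spherical harmonics as restrictions of polynomials -/

/-- The polynomial `∑ᵢ Xᵢ²`. -/
noncomputable def normSqPoly (d : ℕ) : MvPolynomial (Fin (d + 1)) ℂ := ∑ i, X i ^ 2

lemma normSqPoly_isHomogeneous : (normSqPoly d).IsHomogeneous 2 :=
  IsHomogeneous.sum _ _ _ fun i _ => isHomogeneous_X_pow i 2

lemma polyLaplacian_apply (p : MvPolynomial (Fin (d + 1)) ℂ) :
    polyLaplacian d p = ∑ i, pderiv i (pderiv i p) := by
  simp [polyLaplacian]

lemma polyLaplacian_isHomogeneous {p : MvPolynomial (Fin (d + 1)) ℂ} {l : ℕ}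
    (hp : p.IsHomogeneous (l + 2)) : (polyLaplacian d p).IsHomogeneous l := by
  rw [polyLaplacian_apply]
  exact IsHomogeneous.sum _ _ _ fun i _ => (hp.pderiv (i := i)).pderiv (i := i)

lemma polyLaplacian_eq_zero_of_lt_two {p : MvPolynomial (Fin (d + 1)) ℂ} {l : ℕ}
    (hp : p.IsHomogeneous l) (hl : l < 2) : polyLaplacian d p = 0 := by
  rw [polyLaplacian_apply]
  refine Finset.sum_eq_zero fun i _ => ?_
  have h : (pderiv i p).IsHomogeneous 0 := by
    have := hp.pderiv (i := i)
    rwa [show l - 1 = 0 by omega] at this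
  rw [← totalDegree_zero_iff_isHomogeneous, totalDegree_eq_zero_iff_eq_C] at h
  rw [h, pderiv_C]

lemma pderiv_normSqPoly (i : Fin (d + 1)) : pderiv i (normSqPoly d) = 2 * X i := by
  simp only [normSqPoly, map_sum, pderiv_pow]
  rw [Finset.sum_eq_single i]
  · simp
  · intro j _ hj
    rw [pderiv_X_of_ne hj]; simp
  · simp

/-- Leibniz' rule; the cross term is 4 ∑ X_i ∂_i g, which Euler's identity turns into 4 l g. -/
lemma polyLaplacian_normSqPoly_mul {g : MvPolynomial (Fin (d + 1)) ℂ} {l : ℕ}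
    (hg : g.IsHomogeneous l) :
    polyLaplacian d (normSqPoly d * g) =
      C (2 * ((d : ℂ) + 1) + 4 * l) * g + normSqPoly d * polyLaplacian d g := by
  have key : ∀ i : Fin (d + 1), pderiv i (pderiv i (normSqPoly d * g)) =
      2 * g + 4 * (X i * pderiv i g) + normSqPoly d * pderiv i (pderiv i g) := by
    intro i
    have h2 : pderiv i (2 : MvPolynomial (Fin (d + 1)) ℂ) = 0 := by
      rw [show (2 : MvPolynomial (Fin (d + 1)) ℂ) = C 2 from (map_ofNat C 2).symm, pderiv_C]
    simp only [pderiv_mul, map_add, pderiv_normSqPoly, h2, pderiv_X_self]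
    ring
  rw [polyLaplacian_apply, polyLaplacian_apply, Finset.sum_congr rfl fun i _ => key i,
    Finset.sum_add_distrib, Finset.sum_add_distrib, ← Finset.mul_sum, ← Finset.mul_sum,
    hg.sum_X_mul_pderiv]
  simp only [Finset.sum_const, Finset.card_univ, Fintype.card_fin, nsmul_eq_mul, map_add, map_mul,
    map_natCast, map_one, map_ofNat, Finset.mul_sum]
  push_cast
  ring

/-- The operators `g ↦ a g + Δ(|x|² g)`, `a ≥ 0`, are surjective on homogeneous polynomials. -/
lemma exists_polyLaplacian_normSqPoly_mul (l : ℕ) :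
    ∀ a : ℕ, ∀ p : MvPolynomial (Fin (d + 1)) ℂ, p.IsHomogeneous l →
      ∃ g : MvPolynomial (Fin (d + 1)) ℂ, g.IsHomogeneous l ∧
        C (a : ℂ) * g + polyLaplacian d (normSqPoly d * g) = p := by
  induction l using Nat.strong_induction_on with
  | _ l ih =>
    intro a p hp
    -- With this c the equation reads c g + |x|² Δg = p. Put u = Δg, so that g = c⁻¹ (p - |x|² u).
    -- Applying Δ gives c u + Δ(|x|² u) = Δp, the same problem in degree l - 2 with c in place of a;
    -- this is why a varies in the induction.
    set c : ℕ := a + (2 * (d + 1) + 4 * l) with hc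
    have hc0 : (c : ℂ) ≠ 0 := Nat.cast_ne_zero.mpr (by omega)
    have hC : C (c : ℂ) * C (c : ℂ)⁻¹ = (1 : MvPolynomial (Fin (d + 1)) ℂ) := by
      rw [← C_mul, mul_inv_cancel₀ hc0, C_1]
    have hcC : C (c : ℂ) = (C (a : ℂ) + C (2 * ((d : ℂ) + 1) + 4 * l) :
        MvPolynomial (Fin (d + 1)) ℂ) := by
      rw [← C_add, hc]; push_cast; rfl
    obtain ⟨u, hu, hug⟩ : ∃ u : MvPolynomial (Fin (d + 1)) ℂ,
        (normSqPoly d * u).IsHomogeneous l ∧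
          C (c : ℂ) * u + polyLaplacian d (normSqPoly d * u) = polyLaplacian d p := by
      rcases lt_or_ge l 2 with hl | hl
      · refine ⟨0, by simpa using isHomogeneous_zero _ _ l, ?_⟩
        simp [polyLaplacian_eq_zero_of_lt_two hp hl]
      · obtain ⟨l, rfl⟩ := Nat.exists_eq_add_of_le' hl
        obtain ⟨u, hu, h⟩ := ih l (by omega) c _ (polyLaplacian_isHomogeneous hp)
        exact ⟨u, by simpa [add_comm] using normSqPoly_isHomogeneous.mul hu, h⟩
    have hg : (C (c : ℂ)⁻¹ * (p - normSqPoly d * u)).IsHomogeneous l := (hp.sub hu).C_mul _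
    refine ⟨_, hg, ?_⟩
    have hlap : polyLaplacian d (C (c : ℂ)⁻¹ * (p - normSqPoly d * u)) = u := by
      rw [C_mul', map_smul, map_sub, ← hug, add_sub_cancel_right, ← C_mul', ← mul_assoc, mul_comm
        (C _) (C _), hC, one_mul]
    rw [polyLaplacian_normSqPoly_mul hg, hlap, ← add_assoc, ← add_mul, ← hcC, ← mul_assoc, hC]
    ring

lemma restrictToSphere_apply (p : MvPolynomial (Fin (d + 1)) ℂ) (x : Sph d) :
    restrictToSphere d p x =
      aeval (fun i => (((x : EuclideanSpace ℝ (Fin (d + 1))) i : ℝ) : ℂ)) p := rfl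

lemma restrictToSphere_mul (p q : MvPolynomial (Fin (d + 1)) ℂ) :
    restrictToSphere d (p * q) = restrictToSphere d p * restrictToSphere d q := by
  ext x; simp [restrictToSphere_apply]

lemma sum_sq_coord (x : Sph d) :
    ∑ i, ((x : EuclideanSpace ℝ (Fin (d + 1))) i) ^ 2 = 1 := by
  have h := x.2
  rw [mem_sphere_zero_iff_norm] at h
  rw [← EuclideanSpace.real_norm_sq_eq, h, one_pow]

lemma restrictToSphere_normSqPoly : restrictToSphere d (normSqPoly d) = 1 := by
  ext x
  rw [restrictToSphere_apply, normSqPoly]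
  simp only [map_sum, map_pow, aeval_X, Pi.one_apply]
  exact_mod_cast congrArg (fun t : ℝ => (t : ℂ)) (sum_sq_coord x)

lemma sphericalHarmonics_le_harmonicsUpTo {l L : ℕ} (h : l ≤ L) :
    sphericalHarmonics d l ≤ harmonicsUpTo d L :=
  le_iSup₂_of_le l h le_rfl

lemma harmonicsUpTo_mono {a b : ℕ} (h : a ≤ b) : harmonicsUpTo d a ≤ harmonicsUpTo d b :=
  iSup₂_le fun _ hl => sphericalHarmonics_le_harmonicsUpTo (hl.trans h)

/-- Choose q of degree l - 2 with Δ(|x|² q) = Δp. Then p - |x|² q is harmonic, and |x|² q agrees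
with q on the sphere, so induction on the degree applies. -/
lemma restrictToSphere_mem_of_isHomogeneous (l : ℕ) :
    ∀ p : MvPolynomial (Fin (d + 1)) ℂ, p.IsHomogeneous l →
      restrictToSphere d p ∈ harmonicsUpTo d l := by
  induction l using Nat.strong_induction_on with
  | _ l ih =>
    intro p hp
    rcases lt_or_ge l 2 with hl | hl
    · exact sphericalHarmonics_le_harmonicsUpTo le_rfl
        ⟨p, ⟨hp, LinearMap.mem_ker.mpr (polyLaplacian_eq_zero_of_lt_two hp hl)⟩, rfl⟩
    · obtain ⟨l, rfl⟩ := Nat.exists_eq_add_of_le' hl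
      obtain ⟨q, hq, h⟩ := exists_polyLaplacian_normSqPoly_mul l 0 _
        (polyLaplacian_isHomogeneous hp)
      rw [Nat.cast_zero, C_0, zero_mul, zero_add] at h
      have hr : (normSqPoly d * q).IsHomogeneous (l + 2) := by
        simpa [add_comm] using normSqPoly_isHomogeneous.mul hq
      have h1 : restrictToSphere d (p - normSqPoly d * q) ∈ harmonicsUpTo d (l + 2) :=
        sphericalHarmonics_le_harmonicsUpTo le_rfl
          ⟨_, ⟨hp.sub hr, LinearMap.mem_ker.mpr (by rw [map_sub, h, sub_self])⟩, rfl⟩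
      have h2 := harmonicsUpTo_mono (Nat.le_add_right l 2) (ih l (by omega) q hq)
      rw [map_sub, restrictToSphere_mul, restrictToSphere_normSqPoly, one_mul] at h1
      simpa using add_mem h1 h2

/-- `Π_L` consists of the restrictions of the polynomials of degree at most `L`. -/
theorem harmonicsUpTo_eq_map (d L : ℕ) :
    harmonicsUpTo d L =
      (restrictTotalDegree (Fin (d + 1)) ℂ L).map (restrictToSphere d) := by
  apply le_antisymm
  · refine iSup₂_le fun l hl => Submodule.map_mono fun p hp => ?_
    rw [mem_restrictTotalDegree]
    exact (IsHomogeneous.totalDegree_le hp.1).trans hl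
  · rintro _ ⟨p, hp, rfl⟩
    rw [SetLike.mem_coe, mem_restrictTotalDegree] at hp
    rw [← sum_homogeneousComponent p, map_sum]
    refine sum_mem fun i hi => harmonicsUpTo_mono ?_
      (restrictToSphere_mem_of_isHomogeneous i _ (homogeneousComponent_isHomogeneous i p))
    rw [Finset.mem_range] at hi
    omega

lemma restrictToSphere_mem {p : MvPolynomial (Fin (d + 1)) ℂ} {L : ℕ} (hp : p.totalDegree ≤ L) :
    restrictToSphere d p ∈ harmonicsUpTo d L := by
  rw [harmonicsUpTo_eq_map]
  exact ⟨p, (mem_restrictTotalDegree _ _ _).mpr hp, rfl⟩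

lemma exists_restrictToSphere_eq {f : Sph d → ℂ} {L : ℕ} (hf : f ∈ harmonicsUpTo d L) :
    ∃ p : MvPolynomial (Fin (d + 1)) ℂ, p.totalDegree ≤ L ∧ restrictToSphere d p = f := by
  rw [harmonicsUpTo_eq_map] at hf
  obtain ⟨p, hp, h⟩ := hf
  exact ⟨p, (mem_restrictTotalDegree _ _ _).mp hp, h⟩

instance (d L : ℕ) : FiniteDimensional ℂ (harmonicsUpTo d L) := by
  rw [harmonicsUpTo_eq_map]; infer_instance

lemma mul_mem_harmonicsUpTo {f g : Sph d → ℂ} {a b : ℕ} (hf : f ∈ harmonicsUpTo d a)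
    (hg : g ∈ harmonicsUpTo d b) : f * g ∈ harmonicsUpTo d (a + b) := by
  obtain ⟨p, hp, rfl⟩ := exists_restrictToSphere_eq hf
  obtain ⟨q, hq, rfl⟩ := exists_restrictToSphere_eq hg
  rw [← restrictToSphere_mul]
  exact restrictToSphere_mem ((totalDegree_mul _ _).trans (add_le_add hp hq))

lemma const_mem_harmonicsUpTo (c : ℂ) (L : ℕ) : (fun _ : Sph d => c) ∈ harmonicsUpTo d L := by
  have h := restrictToSphere_mem (d := d) (p := C c) (L := L) (by simp)
  convert h using 1
  ext x; simp [restrictToSphere_apply]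

lemma coord_mem_harmonicsUpTo (i : Fin (d + 1)) :
    (fun x : Sph d => (((x : EuclideanSpace ℝ (Fin (d + 1))) i : ℝ) : ℂ)) ∈
      harmonicsUpTo d 1 := by
  have h := restrictToSphere_mem (d := d) (p := X i) (L := 1) (by simp)
  convert h using 1
  ext x; simp [restrictToSphere_apply]

/-- Induction principle: `Π_L` is generated by the products of at most `L` coordinates. -/
lemma harmonicsUpTo_induction {P : ℕ → (Sph d → ℂ) → Prop}
    (const : ∀ c L, P L fun _ => c)
    (add : ∀ L f g, P L f → P L g → P L (f + g))
    (coord : ∀ L f i, P L f →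
      P (L + 1) (f * fun x : Sph d => (((x : EuclideanSpace ℝ (Fin (d + 1))) i : ℝ) : ℂ)))
    {L : ℕ} {f : Sph d → ℂ} (hf : f ∈ harmonicsUpTo d L) : P L f := by
  obtain ⟨p, hp, rfl⟩ := exists_restrictToSphere_eq hf
  have mono : ∀ L, ∀ s : Fin (d + 1) →₀ ℕ, s.degree ≤ L → ∀ c : ℂ,
      P L (restrictToSphere d (monomial s c)) := by
    intro L
    have h0 : ∀ (L : ℕ) (c : ℂ), P L (restrictToSphere d (monomial 0 c)) := by
      intro L c
      convert const c L using 1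
      ext x; simp [restrictToSphere_apply]
    induction L with
    | zero =>
      intro s hs c
      rw [(Finsupp.degree_eq_zero_iff s).mp (Nat.le_zero.mp hs)]
      exact h0 0 c
    | succ L ih =>
      intro s hs c
      by_cases h : s = 0
      · rw [h]; exact h0 _ c
      · obtain ⟨i, hi⟩ := Finsupp.ne_iff.mp h
        rw [Finsupp.coe_zero, Pi.zero_apply] at hi
        have hs' : s - Finsupp.single i 1 + Finsupp.single i 1 = s :=
          tsub_add_cancel_of_le (Finsupp.single_le_iff.mpr (Nat.one_le_iff_ne_zero.mpr hi))
        have hdeg : (s - Finsupp.single i 1).degree ≤ L := by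
          have := congrArg Finsupp.degree hs'
          rw [map_add, Finsupp.degree_single] at this
          omega
        convert coord L _ i (ih _ hdeg c) using 1
        ext x
        rw [Pi.mul_apply, restrictToSphere_apply, restrictToSphere_apply]
        conv_lhs => rw [← hs']
        rw [monomial_add_single, map_mul, pow_one, aeval_X]
  rw [as_sum p, map_sum]
  have hsum : ∀ S ⊆ p.support, P L (∑ s ∈ S, restrictToSphere d (monomial s (coeff s p))) := by
    intro S
    induction S using Finset.induction_on with
    | empty => intro _; rw [Finset.sum_empty]; exact const 0 L
    | insert a S ha ih =>
      intro hS
      rw [Finset.sum_insert ha]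
      refine add _ _ _ (mono _ _ ?_ _) (ih ((Finset.subset_insert _ _).trans hS))
      exact (le_totalDegree (hS (Finset.mem_insert_self _ _))).trans hp
  exact hsum _ subset_rfl

lemma continuous_of_mem_harmonicsUpTo {f : Sph d → ℂ} {L : ℕ} (hf : f ∈ harmonicsUpTo d L) :
    Continuous f := by
  refine harmonicsUpTo_induction (P := fun _ f => Continuous f) (fun _ _ => continuous_const)
    (fun _ _ _ hf hg => hf.add hg) (fun _ f i hf => hf.mul ?_) hf
  fun_prop

end Polynomials

/-! ### Action of linear isometries on the sphere -/

/-- The restriction to the sphere of a linear isometry. -/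
noncomputable def sphereMap (A : EuclideanSpace ℝ (Fin (d + 1)) ≃ₗᵢ[ℝ] EuclideanSpace ℝ (Fin (d + 1)))
    (x : Sph d) : Sph d :=
  ⟨A x, by simp⟩

lemma continuous_sphereMap
    (A : EuclideanSpace ℝ (Fin (d + 1)) ≃ₗᵢ[ℝ] EuclideanSpace ℝ (Fin (d + 1))) :
    Continuous (sphereMap A) :=
  (A.continuous.comp continuous_subtype_val).subtype_mk _

-- The surface measure of s is, up to a constant, the volume of the cone (0,1)·s, and A maps cones
-- to cones and preserves volume.
open scoped Pointwise in
lemma measurePreserving_sphereMap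
    (A : EuclideanSpace ℝ (Fin (d + 1)) ≃ₗᵢ[ℝ] EuclideanSpace ℝ (Fin (d + 1))) :
    MeasurePreserving (sphereMap A) (surfaceMeasure d) (surfaceMeasure d) := by
  refine ⟨(continuous_sphereMap A).measurable, ?_⟩
  ext s hs
  have hs' : MeasurableSet (sphereMap A ⁻¹' s) := (continuous_sphereMap A).measurable hs
  rw [Measure.map_apply (continuous_sphereMap A).measurable hs, surfaceMeasure,
    Measure.toSphere_apply' _ hs, Measure.toSphere_apply' _ hs']
  congr 1
  have hset : Set.Ioo (0 : ℝ) 1 • ((↑) '' (sphereMap A ⁻¹' s) :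
        Set (EuclideanSpace ℝ (Fin (d + 1)))) =
      A ⁻¹' (Set.Ioo (0 : ℝ) 1 • ((↑) '' s : Set (EuclideanSpace ℝ (Fin (d + 1))))) := by
    ext v
    simp only [Set.mem_smul, Set.mem_image, Set.mem_preimage]
    constructor
    · rintro ⟨t, ht, _, ⟨x, hx, rfl⟩, rfl⟩
      exact ⟨t, ht, _, ⟨sphereMap A x, hx, rfl⟩, by simp [sphereMap]⟩
    · rintro ⟨t, ht, _, ⟨x, hx, rfl⟩, h⟩
      refine ⟨t, ht, _, ⟨sphereMap A.symm x, ?_, rfl⟩, ?_⟩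
      · simpa [sphereMap] using hx
      · apply A.injective
        rw [← h]; simp [sphereMap]
  rw [hset]
  exact A.measurePreserving.measure_preimage_equiv (f := A.toMeasurableEquiv) _

lemma comp_sphereMap_mem {f : Sph d → ℂ} {L : ℕ} (hf : f ∈ harmonicsUpTo d L)
    (A : EuclideanSpace ℝ (Fin (d + 1)) ≃ₗᵢ[ℝ] EuclideanSpace ℝ (Fin (d + 1))) :
    f ∘ sphereMap A ∈ harmonicsUpTo d L := by
  refine harmonicsUpTo_induction (P := fun L f => f ∘ sphereMap A ∈ harmonicsUpTo d L)
    (fun c L => const_mem_harmonicsUpTo c L) (fun _ _ _ hf hg => add_mem hf hg)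
    (fun L f i hf => mul_mem_harmonicsUpTo hf ?_) hf
  have h : (fun x : Sph d => (((sphereMap A x : EuclideanSpace ℝ (Fin (d + 1))) i : ℝ) : ℂ)) =
      ∑ j, ((A (EuclideanSpace.single j 1) i : ℝ) : ℂ) •
        fun x : Sph d => (((x : EuclideanSpace ℝ (Fin (d + 1))) j : ℝ) : ℂ) := by
    ext x
    have hx : (x : EuclideanSpace ℝ (Fin (d + 1))) =
        ∑ j, (x : EuclideanSpace ℝ (Fin (d + 1))) j • EuclideanSpace.single j (1 : ℝ) := by
      simpa using ((EuclideanSpace.basisFun (Fin (d + 1)) ℝ).sum_repr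
        (x : EuclideanSpace ℝ (Fin (d + 1)))).symm
    have h2 : A x i = ∑ j, A (EuclideanSpace.single j 1) i *
        (x : EuclideanSpace ℝ (Fin (d + 1))) j := by
      conv_lhs => rw [hx]
      simp [mul_comm]
    simp [sphereMap, h2]
  change (fun x : Sph d => (((sphereMap A x : EuclideanSpace ℝ (Fin (d + 1))) i : ℝ) : ℂ)) ∈ _
  rw [h]
  exact sum_mem fun j _ => Submodule.smul_mem _ _ (coord_mem_harmonicsUpTo j)

/-- The reflection in the hyperplane orthogonal to x - y exchanges two vectors of equal norm. -/
lemma exists_sphereMap_eq (x y : Sph d) :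
    ∃ A : EuclideanSpace ℝ (Fin (d + 1)) ≃ₗᵢ[ℝ] EuclideanSpace ℝ (Fin (d + 1)),
      sphereMap A x = y :=
  ⟨_, Subtype.ext (Submodule.reflection_sub (by simp))⟩

instance (d : ℕ) : IsFiniteMeasure (surfaceMeasure d) := by
  unfold surfaceMeasure; infer_instance

instance (d : ℕ) : (surfaceMeasure d).IsOpenPosMeasure := by
  unfold surfaceMeasure; infer_instance

/-! ### The reproducing kernel of `Π_L` -/

lemma integrable_of_continuous {F : Type*} [NormedAddCommGroup F] {f : Sph d → F}
    (hf : Continuous f) : Integrable f (surfaceMeasure d) :=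
  hf.integrable_of_hasCompactSupport (HasCompactSupport.of_compactSpace f)

lemma eq_zero_of_integral_norm_rpow_eq_zero {f : Sph d → ℂ} (hf : Continuous f) {p : ℝ}
    (hp : 0 < p) (h : ∫ x, ‖f x‖ ^ p ∂(surfaceMeasure d) = 0) : f = 0 := by
  have hc : Continuous fun x => ‖f x‖ ^ p := hf.norm.rpow_const fun _ => Or.inr hp.le
  rw [integral_eq_zero_iff_of_nonneg (fun x => by positivity) (integrable_of_continuous hc)] at h
  have h' := Continuous.ae_eq_iff_eq (surfaceMeasure d) hc continuous_const |>.mp h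
  ext x
  exact norm_eq_zero.mp ((Real.rpow_eq_zero (norm_nonneg _) hp.ne').mp (congrFun h' x))

/-! ### Hilbert space facts for an inner product given as a core -/

section Core

variable {V : Type*} [AddCommGroup V] [Module ℂ V]

lemma core_cauchy_schwarz (c : InnerProductSpace.Core ℂ V) (v w : V) :
    ‖c.inner v w‖ ^ 2 ≤ (c.inner v v).re * (c.inner w w).re := by
  let := c.toNormedAddCommGroup
  let : InnerProductSpace ℂ V := InnerProductSpace.ofCore c.toCore
  have h := norm_inner_le_norm (𝕜 := ℂ) v w
  have hv := inner_self_eq_norm_sq (𝕜 := ℂ) v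
  have hw := inner_self_eq_norm_sq (𝕜 := ℂ) w
  change ‖inner ℂ v w‖ ^ 2 ≤ RCLike.re (inner ℂ v v) * RCLike.re (inner ℂ w w)
  rw [hv, hw, ← mul_pow]
  gcongr

lemma core_exists_repr [FiniteDimensional ℂ V] (c : InnerProductSpace.Core ℂ V)
    (φ : V →ₗ[ℂ] ℂ) : ∃ v, ∀ w, c.inner v w = φ w := by
  let := c.toNormedAddCommGroup
  let : InnerProductSpace ℂ V := InnerProductSpace.ofCore c.toCore
  have : CompleteSpace V := FiniteDimensional.complete ℂ V
  refine ⟨(InnerProductSpace.toDual ℂ V).symm (LinearMap.toContinuousLinearMap φ), fun w => ?_⟩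
  exact InnerProductSpace.toDual_symm_apply

lemma core_exists_orthonormalBasis [FiniteDimensional ℂ V] (c : InnerProductSpace.Core ℂ V) :
    ∃ e : Fin (Module.finrank ℂ V) → V, (∀ i, c.inner (e i) (e i) = 1) ∧
      ∀ v, ∑ i, ‖c.inner v (e i)‖ ^ 2 = (c.inner v v).re := by
  let := c.toNormedAddCommGroup
  let : InnerProductSpace ℂ V := InnerProductSpace.ofCore c.toCore
  refine ⟨stdOrthonormalBasis ℂ V, fun i => ?_, fun v => ?_⟩
  · exact inner_self_eq_one_of_norm_eq_one ((stdOrthonormalBasis ℂ V).norm_eq_one i)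
  · have := (stdOrthonormalBasis ℂ V).sum_sq_norm_inner_left v
    have hv := inner_self_eq_norm_sq (𝕜 := ℂ) v
    exact this.trans hv.symm

end Core

/-- The `L²` inner product on `Π_L`. -/
@[reducible] noncomputable def harmonicsCore (d L : ℕ) : InnerProductSpace.Core ℂ (harmonicsUpTo d L) where
  inner f g := ∫ x, starRingEnd ℂ (f.1 x) * g.1 x ∂(surfaceMeasure d)
  conj_inner_symm f g := by
    rw [← integral_conj]
    simp [mul_comm]
  re_inner_nonneg f := by
    have : (fun x => starRingEnd ℂ (f.1 x) * f.1 x) = fun x => ((‖f.1 x‖ ^ 2 : ℝ) : ℂ) := by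
      ext x; rw [Complex.conj_mul']; push_cast; rfl
    rw [this, integral_complex_ofReal]
    simp only [RCLike.re_to_complex, Complex.ofReal_re]
    exact integral_nonneg fun x => by positivity
  add_left f g h := by
    have hf := continuous_of_mem_harmonicsUpTo f.2
    have hg := continuous_of_mem_harmonicsUpTo g.2
    have hh := continuous_of_mem_harmonicsUpTo h.2
    rw [← integral_add (integrable_of_continuous (by fun_prop))
      (integrable_of_continuous (by fun_prop))]
    simp [add_mul]
  smul_left f g r := by
    rw [← integral_const_mul]
    simp [mul_assoc]
  definite f h := by
    have hf := continuous_of_mem_harmonicsUpTo f.2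
    have : (fun x => starRingEnd ℂ (f.1 x) * f.1 x) = fun x => ((‖f.1 x‖ ^ (2 : ℝ) : ℝ) : ℂ) := by
      ext x; rw [Complex.conj_mul']; norm_cast
    rw [this, integral_complex_ofReal] at h
    exact Subtype.ext (eq_zero_of_integral_norm_rpow_eq_zero hf two_pos (by simpa using h))

lemma harmonicsCore_inner_self {L : ℕ} (f : harmonicsUpTo d L) :
    ((harmonicsCore d L).inner f f).re = ∫ x, ‖f.1 x‖ ^ 2 ∂(surfaceMeasure d) := by
  have : (fun x => starRingEnd ℂ (f.1 x) * f.1 x) = fun x => ((‖f.1 x‖ ^ 2 : ℝ) : ℂ) := by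
    ext x; rw [Complex.conj_mul']; push_cast; rfl
  change (∫ x, starRingEnd ℂ (f.1 x) * f.1 x ∂(surfaceMeasure d)).re = _
  rw [this, integral_complex_ofReal]
  simp

instance : Nonempty (Sph d) := ⟨⟨EuclideanSpace.single 0 1, by simp⟩⟩

/-- k x represents evaluation at x for the L² inner product. Isometries act transitively and
preserve the norm, so the diagonal is a constant κ, and Cauchy-Schwarz bounds the kernel by κ.
Integrating κ = ∑ |e_i(x)|² over an orthonormal basis gives the dimension. -/
lemma exists_reproducingKernel (d L : ℕ) :
    ∃ (κ : ℝ) (k : Sph d → Sph d → ℂ), (∀ x, k x ∈ harmonicsUpTo d L) ∧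
      (∀ x, k x x = κ) ∧ (∀ x y, ‖k x y‖ ≤ κ) ∧
      (∀ x, ∫ y, ‖k x y‖ ^ 2 ∂(surfaceMeasure d) = κ) ∧
      κ * (surfaceMeasure d).real Set.univ = dimUpTo d L := by
  set c := harmonicsCore d L with hc
  have hev : ∀ x : Sph d, ∃ v : harmonicsUpTo d L, ∀ w : harmonicsUpTo d L,
      c.inner v w = w.1 x := fun x =>
    core_exists_repr c ((LinearMap.proj x).comp (harmonicsUpTo d L).subtype)
  choose K hK using hev
  have hself : ∀ x, (c.inner (K x) (K x)).re = ∫ y, ‖(K x).1 y‖ ^ 2 ∂(surfaceMeasure d) :=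
    fun x => harmonicsCore_inner_self _
  have hnn : ∀ x, 0 ≤ (c.inner (K x) (K x)).re := fun x => c.re_inner_nonneg _
  have hdiag : ∀ x, (K x).1 x = ((c.inner (K x) (K x)).re : ℂ) := by
    intro x
    have := c.conj_inner_symm (K x) (K x)
    rw [← hK x (K x)]
    exact (Complex.conj_eq_iff_re.mp this).symm
  have hle : ∀ x y, (c.inner (K y) (K y)).re ≤ (c.inner (K x) (K x)).re := by
    intro x y
    obtain ⟨A, hA⟩ := exists_sphereMap_eq x y
    -- f has the norm of K y and takes the value K_y(y) at x, so Cauchy-Schwarz against K x gives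
    -- K_y(y)² ≤ K_x(x) K_y(y).
    set f : harmonicsUpTo d L := ⟨_, comp_sphereMap_mem (K y).2 A⟩ with hf
    have h1 : (c.inner f f).re = (c.inner (K y) (K y)).re := by
      rw [harmonicsCore_inner_self, harmonicsCore_inner_self]
      have hmp := measurePreserving_sphereMap A
      have h := integral_map (μ := surfaceMeasure d) hmp.measurable.aemeasurable (f := fun z => ‖(K y).1 z‖ ^ 2)
        ((continuous_of_mem_harmonicsUpTo (K y).2).norm.pow 2).aestronglyMeasurable
      rw [hmp.map_eq] at h
      exact h.symm
    have h2 := core_cauchy_schwarz c (K x) f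
    rw [hK x f, h1, hf] at h2
    simp only [Function.comp_apply, hA, hdiag y, Complex.norm_real, Real.norm_eq_abs,
      sq_abs] at h2
    rw [sq] at h2
    rcases (hnn y).eq_or_lt with h0 | h0
    · rw [← h0]; exact hnn x
    · exact le_of_mul_le_mul_right h2 h0
  obtain ⟨x₀⟩ : Nonempty (Sph d) := inferInstance
  have heq : ∀ x, (c.inner (K x) (K x)).re = (c.inner (K x₀) (K x₀)).re :=
    fun x => le_antisymm (hle _ _) (hle _ _)
  refine ⟨(c.inner (K x₀) (K x₀)).re, fun x => (K x).1, fun x => (K x).2, fun x => ?_,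
    fun x y => ?_, fun x => ?_, ?_⟩
  · exact (hdiag x).trans (by rw [heq x])
  · have := core_cauchy_schwarz c (K y) (K x)
    rw [hK, heq x, heq y, ← sq] at this
    exact le_of_sq_le_sq this (hnn x₀)
  · rw [← heq x, hself]
  · obtain ⟨e, he1, he⟩ := core_exists_orthonormalBasis c
    have h1 : ∀ x, ∑ i, ‖(e i).1 x‖ ^ 2 = (c.inner (K x₀) (K x₀)).re := by
      intro x
      rw [← heq x, ← he (K x)]
      exact Finset.sum_congr rfl fun i _ => by rw [hK]
    have h2 : ∫ x, ∑ i, ‖(e i).1 x‖ ^ 2 ∂(surfaceMeasure d) = dimUpTo d L := by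
      rw [integral_finsetSum _ fun i _ => integrable_of_continuous
        (f := fun x => ‖(e i).1 x‖ ^ 2) ((continuous_of_mem_harmonicsUpTo (e i).2).norm.pow 2)]
      have h3 : ∀ i, ∫ x, ‖(e i).1 x‖ ^ 2 ∂(surfaceMeasure d) = 1 := fun i =>
        (harmonicsCore_inner_self (e i)).symm.trans (congrArg Complex.re (he1 i))
      simp [h3, dimUpTo]
    rw [← h2, integral_congr_ae (Eventually.of_forall h1), integral_const, smul_eq_mul, mul_comm]

/-! ### The dimension of `Π_L` -/

section Dimension

open MvPolynomial

/-- The dimension of the space of polynomials of degree at most `L` in `d` variables. -/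
noncomputable def polyDim (d L : ℕ) : ℕ := Module.finrank ℂ (restrictTotalDegree (Fin d) ℂ L)

lemma finite_finsupp_sum_le (d L : ℕ) :
    Finite {s : Fin d →₀ ℕ | (s.sum fun _ e => e) ≤ L} :=
  have : Module.Finite ℂ (restrictSupport ℂ {s : Fin d →₀ ℕ | (s.sum fun _ e => e) ≤ L}) :=
    inferInstanceAs (Module.Finite ℂ (restrictTotalDegree (Fin d) ℂ L))
  Module.Finite.finite_basis
    (basisRestrictSupport ℂ {s : Fin d →₀ ℕ | (s.sum fun _ e => e) ≤ L})

lemma polyDim_eq_card (d L : ℕ) :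
    polyDim d L = Nat.card {s : Fin d →₀ ℕ | (s.sum fun _ e => e) ≤ L} :=
  Module.finrank_eq_nat_card_basis
    (basisRestrictSupport ℂ {s : Fin d →₀ ℕ | (s.sum fun _ e => e) ≤ L})

/-- An exponent is determined by its parities and its halves, and halving total degree 2M + 1 leaves
at most M. -/
lemma polyDim_two_mul_add_one_le (d M : ℕ) : polyDim d (2 * M + 1) ≤ 2 ^ d * polyDim d M := by
  rw [polyDim_eq_card, polyDim_eq_card]
  have := finite_finsupp_sum_le d M
  have hcard : 2 ^ d * Nat.card {s : Fin d →₀ ℕ | (s.sum fun _ e => e) ≤ M} =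
      Nat.card ((Fin d → Fin 2) × {s : Fin d →₀ ℕ | (s.sum fun _ e => e) ≤ M}) := by
    rw [Nat.card_prod]; simp
  rw [hcard]
  have hhalf : ∀ s : Fin d →₀ ℕ, (s.sum fun _ e => e) ≤ 2 * M + 1 →
      ((s.mapRange (· / 2) rfl).sum fun _ e => e) ≤ M := by
    intro s hs
    rw [Finsupp.sum_fintype _ _ (by simp)] at hs ⊢
    have h2 : 2 * ∑ i, s.mapRange (· / 2) rfl i ≤ ∑ i, s i := by
      rw [Finset.mul_sum]
      exact Finset.sum_le_sum fun i _ => by simp only [Finsupp.mapRange_apply]; omega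
    omega
  refine Nat.card_le_card_of_injective (fun s => (fun i => ⟨s.1 i % 2, Nat.mod_lt _ two_pos⟩,
    ⟨s.1.mapRange (· / 2) rfl, hhalf _ s.2⟩)) ?_
  rintro ⟨s, hs⟩ ⟨t, ht⟩ h
  simp only [Prod.mk.injEq, Subtype.mk.injEq] at h
  refine Subtype.ext (Finsupp.ext fun i => ?_)
  have h1 := congrArg Fin.val (congrFun h.1 i)
  have h2 := DFunLike.congr_fun h.2 i
  simp only [Finsupp.mapRange_apply] at h1 h2
  change s i = t i
  omega

lemma polyDim_mono (d : ℕ) {a b : ℕ} (h : a ≤ b) : polyDim d a ≤ polyDim d b :=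
  Submodule.finrank_mono fun p hp => by
    rw [mem_restrictTotalDegree] at hp ⊢
    exact hp.trans h

lemma succ_le_polyDim (hd : 1 ≤ d) (L : ℕ) : L + 1 ≤ polyDim d L := by
  rw [polyDim_eq_card]
  have := finite_finsupp_sum_le d L
  conv_lhs => rw [← Nat.card_fin (L + 1)]
  refine Nat.card_le_card_of_injective (fun k => ⟨Finsupp.single ⟨0, hd⟩ k.1, ?_⟩) ?_
  · change (Finsupp.sum _ _) ≤ L
    rw [Finsupp.sum_single_index rfl]
    omega
  · intro a b h
    exact Fin.ext (Finsupp.single_injective _ (Subtype.ext_iff.mp h))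

/-- Polynomials in the last `d` coordinates as functions on `𝕊^d`. -/
noncomputable def tailRestrict (d : ℕ) : MvPolynomial (Fin d) ℂ →ₗ[ℂ] (Sph d → ℂ) :=
  restrictToSphere d ∘ₗ (rename Fin.succ).toLinearMap

lemma tailRestrict_apply (q : MvPolynomial (Fin d) ℂ) (x : Sph d) :
    tailRestrict d q x =
      eval (fun i => (((x : EuclideanSpace ℝ (Fin (d + 1))) (Fin.succ i) : ℝ) : ℂ)) q := by
  rw [tailRestrict, LinearMap.comp_apply, restrictToSphere_apply, AlgHom.toLinearMap_apply,
    aeval_rename, aeval_eq_eval]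
  rfl

/-- The last d coordinates of points of the sphere fill the box (0, 1/(d+1))^d, since its points
have norm at most 1. A polynomial vanishing on a product of infinite sets is zero. -/
lemma tailRestrict_injective : Function.Injective (tailRestrict d) := by
  intro p q hpq
  refine funext_set (fun _ : Fin d => (fun t : ℝ => (t : ℂ)) '' Set.Ioo 0 (1 / ((d : ℝ) + 1)))
    (fun _ => (Set.Ioo_infinite (by positivity)).image Complex.ofReal_injective.injOn) ?_
  intro y hy
  have hy' : ∀ i, ∃ t : ℝ, t ∈ Set.Ioo 0 (1 / ((d : ℝ) + 1)) ∧ (t : ℂ) = y i :=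
    fun i => hy i trivial
  choose t ht hty using hy'
  have hsum : ∑ i, t i ^ 2 ≤ 1 := by
    calc ∑ i, t i ^ 2 ≤ ∑ _i : Fin d, 1 / ((d : ℝ) + 1) := by
          refine Finset.sum_le_sum fun i _ => ?_
          have h1 : 1 / ((d : ℝ) + 1) ≤ 1 := by
            rw [div_le_one (by positivity)]; linarith [(Nat.cast_nonneg d : (0 : ℝ) ≤ d)]
          nlinarith [(ht i).1, (ht i).2]
      _ = d / ((d : ℝ) + 1) := by simp [div_eq_mul_inv]
      _ ≤ 1 := by rw [div_le_one (by positivity)]; linarith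
  let v : EuclideanSpace ℝ (Fin (d + 1)) :=
    WithLp.toLp 2 (Fin.cons (Real.sqrt (1 - ∑ i, t i ^ 2)) t)
  have hv : ‖v‖ = 1 := by
    rw [← sq_eq_sq₀ (norm_nonneg _) zero_le_one, EuclideanSpace.real_norm_sq_eq, Fin.sum_univ_succ]
    simp only [v, Fin.cons_zero, Fin.cons_succ]
    rw [Real.sq_sqrt (by linarith)]
    ring
  have h := congrFun hpq ⟨v, by simpa using hv⟩
  rw [tailRestrict_apply, tailRestrict_apply] at h
  have hvy : (fun i => ((v (Fin.succ i) : ℝ) : ℂ)) = y := by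
    ext i; simp [v, hty]
  simpa only [hvy] using h

lemma polyDim_le_dimUpTo (d L : ℕ) : polyDim d L ≤ dimUpTo d L := by
  rw [polyDim, dimUpTo,
    (Submodule.equivMapOfInjective _ tailRestrict_injective (restrictTotalDegree (Fin d) ℂ
      L)).finrank_eq]
  refine Submodule.finrank_mono ?_
  rintro _ ⟨q, hq, rfl⟩
  rw [SetLike.mem_coe, mem_restrictTotalDegree] at hq
  exact restrictToSphere_mem ((totalDegree_rename_le _ _).trans hq)

/-- On the sphere x₀² = 1 - ∑ x_i², the sum being over the other coordinates. Hence every polynomial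
reduces to a + x₀ b with a, b free of x₀, without raising the degree. -/
lemma dimUpTo_le_two_mul_polyDim (d L : ℕ) : dimUpTo d L ≤ 2 * polyDim d L := by
  let x₀ : Sph d → ℂ := fun x => (((x : EuclideanSpace ℝ (Fin (d + 1))) 0 : ℝ) : ℂ)
  let W := restrictTotalDegree (Fin d) ℂ L
  let B := W.map (tailRestrict d) ⊔ W.map (LinearMap.mulLeft ℂ x₀ ∘ₗ tailRestrict d)
  have hx₀ : ∀ q : MvPolynomial (Fin d) ℂ,
      x₀ ^ 2 * tailRestrict d q = tailRestrict d q - tailRestrict d (q * ∑ i, X i ^ 2) := by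
    intro q
    ext x
    have h := sum_sq_coord x
    rw [Fin.sum_univ_succ] at h
    have h' : (((x : EuclideanSpace ℝ (Fin (d + 1))) 0 : ℝ) : ℂ) ^ 2 = 1 - ∑ i : Fin d,
        (((x : EuclideanSpace ℝ (Fin (d + 1))) (Fin.succ i) : ℝ) : ℂ) ^ 2 := by
      rw [eq_sub_iff_add_eq]; exact_mod_cast h
    simp only [Pi.mul_apply, Pi.pow_apply, Pi.sub_apply, tailRestrict_apply, map_mul, map_sum,
      map_pow, eval_X, x₀, h']
    ring
  have hmem : ∀ k, ∀ q : MvPolynomial (Fin d) ℂ, k + q.totalDegree ≤ L →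
      x₀ ^ k * tailRestrict d q ∈ B := by
    intro k
    induction k using Nat.strong_induction_on with
    | _ k ih =>
      intro q hq
      have hqW : q ∈ W := (mem_restrictTotalDegree _ _ _).mpr (by omega)
      match k with
      | 0 =>
        rw [pow_zero, one_mul]
        exact Submodule.mem_sup_left ⟨q, hqW, rfl⟩
      | 1 =>
        rw [pow_one]
        exact Submodule.mem_sup_right ⟨q, hqW, rfl⟩
      | k + 2 =>
        rw [pow_add, mul_assoc, hx₀, mul_sub]
        refine sub_mem (ih k (by omega) _ (by omega)) (ih k (by omega) _ ?_)
        have hdeg : (∑ i : Fin d, (X i ^ 2 : MvPolynomial (Fin d) ℂ)).totalDegree ≤ 2 :=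
          (IsHomogeneous.sum _ _ _ fun i _ => isHomogeneous_X_pow i 2).totalDegree_le
        have := totalDegree_mul q (∑ i, X i ^ 2)
        omega
  have hle : harmonicsUpTo d L ≤ B := by
    intro f hf
    obtain ⟨p, hp, rfl⟩ := exists_restrictToSphere_eq hf
    have hp' : restrictToSphere d p = ∑ k ∈ (finSuccEquiv ℂ d p).support,
        x₀ ^ k * tailRestrict d ((finSuccEquiv ℂ d p).coeff k) := by
      ext x
      have hcons : (fun i => (((x : EuclideanSpace ℝ (Fin (d + 1))) i : ℝ) : ℂ)) =
          Fin.cons (x₀ x)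
            fun i => (((x : EuclideanSpace ℝ (Fin (d + 1))) (Fin.succ i) : ℝ) : ℂ) := by
        ext i; refine Fin.cases ?_ (fun i => ?_) i <;> simp [x₀]
      rw [restrictToSphere_apply, hcons, aeval_eq_eval]
      change eval _ p = _
      rw [eval_eq_eval_mv_eval', Polynomial.eval_map, Polynomial.eval₂_eq_sum, Polynomial.sum,
        Finset.sum_apply]
      refine Finset.sum_congr rfl fun k _ => ?_
      rw [Pi.mul_apply, Pi.pow_apply, tailRestrict_apply, mul_comm]
    rw [hp']
    refine sum_mem fun k hk => hmem k _ ?_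
    have := totalDegree_coeff_finSuccEquiv_add_le p k (Polynomial.mem_support_iff.mp hk)
    omega
  calc dimUpTo d L ≤ Module.finrank ℂ B := Submodule.finrank_mono hle
    _ ≤ _ := Submodule.finrank_add_le_finrank_add_finrank _ _
    _ ≤ polyDim d L + polyDim d L := add_le_add (Submodule.finrank_map_le _ _)
      (Submodule.finrank_map_le _ _)
    _ = 2 * polyDim d L := by ring

lemma succ_le_dimUpTo (hd : 1 ≤ d) (L : ℕ) : L + 1 ≤ dimUpTo d L :=
  (succ_le_polyDim hd L).trans (polyDim_le_dimUpTo d L)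

/-- This doubling property allows a squared kernel of degree L/2 to be compared with π_L. The odd
case L = 2(L/2) + 1 is the worst. -/
lemma dimUpTo_le_mul_dimUpTo_half (d L : ℕ) : dimUpTo d L ≤ 2 ^ (d + 1) * dimUpTo d (L / 2) :=
  calc dimUpTo d L ≤ 2 * polyDim d L := dimUpTo_le_two_mul_polyDim d L
    _ ≤ 2 * polyDim d (2 * (L / 2) + 1) := by gcongr; exact polyDim_mono d (by omega)
    _ ≤ 2 * (2 ^ d * polyDim d (L / 2)) := by gcongr; exact polyDim_two_mul_add_one_le d _
    _ ≤ 2 * (2 ^ d * dimUpTo d (L / 2)) := by gcongr; exact polyDim_le_dimUpTo d _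
    _ = _ := by ring

end Dimension

/-- Functions in `Π_L` concentrated near a given point. -/
lemma exists_concentrated (d : ℕ) : ∃ c : ℝ, 0 < c ∧ ∀ (L : ℕ) (x : Sph d) (p : ℝ), 1 ≤ p →
    ∃ f ∈ harmonicsUpTo d L, c * dimUpTo d L * ∫ y, ‖f y‖ ^ p ∂(surfaceMeasure d) ≤ ‖f x‖ ^ p ∧
      (0 < dimUpTo d L → 0 < ‖f x‖) := by
  have hσ : 0 < (surfaceMeasure d).real Set.univ :=
    ENNReal.toReal_pos (isOpen_univ.measure_pos _ Set.univ_nonempty).ne' (measure_ne_top _ _)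
  refine ⟨((surfaceMeasure d).real Set.univ * 2 ^ (d + 1))⁻¹, by positivity, fun L x p hp => ?_⟩
  obtain ⟨κ, k, hk, hdiag, hle, hint, hdim⟩ := exists_reproducingKernel d (L / 2)
  have hκ : 0 ≤ κ := (norm_nonneg _).trans (hle x x)
  have hdimle : ((surfaceMeasure d).real Set.univ * 2 ^ (d + 1))⁻¹ * dimUpTo d L ≤ κ := by
    rw [inv_mul_le_iff₀ (by positivity)]
    have : (dimUpTo d L : ℝ) ≤ 2 ^ (d + 1) * dimUpTo d (L / 2) := by
      exact_mod_cast dimUpTo_le_mul_dimUpTo_half d L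
    rw [← hdim] at this
    linarith
  -- The square makes the exponent 2p - 2 nonnegative for every p ≥ 1, so that |k|^(2p) ≤ κ^(2p-2)
  -- |k|² has integral at most κ^(2p-1), while the value at x is κ^(2p).
  refine ⟨k x * k x, harmonicsUpTo_mono (by omega) (mul_mem_harmonicsUpTo (hk x) (hk x)), ?_, ?_⟩
  · have hkc : Continuous (k x) := continuous_of_mem_harmonicsUpTo (hk x)
    have h1 : ∫ y, ‖(k x * k x) y‖ ^ p ∂(surfaceMeasure d) ≤ κ ^ (2 * p - 2) * κ := by
      have hκint : κ ^ (2 * p - 2) * κ =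
          ∫ y, κ ^ (2 * p - 2) * ‖k x y‖ ^ 2 ∂(surfaceMeasure d) := by
        rw [integral_const_mul, hint]
      rw [hκint]
      refine integral_mono (integrable_of_continuous ?_) (integrable_of_continuous ?_) fun y => ?_
      · exact (hkc.mul hkc).norm.rpow_const fun _ => Or.inr (by linarith)
      · exact continuous_const.mul (hkc.norm.pow 2)
      · have : ‖(k x * k x) y‖ ^ p = ‖k x y‖ ^ (2 * p - 2) * ‖k x y‖ ^ 2 := by
          rw [Pi.mul_apply, norm_mul, ← sq, ← Real.rpow_natCast, ← Real.rpow_mul (norm_nonneg _),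
            ← Real.rpow_add_of_nonneg (norm_nonneg _) (by linarith) (by simp)]
          congr 1; push_cast; ring
        rw [this]
        gcongr
        · linarith
        · exact hle x y
    have h2 : ‖(k x * k x) x‖ ^ p = κ * (κ ^ (2 * p - 2) * κ) := by
      rw [Pi.mul_apply, norm_mul, hdiag, Complex.norm_real, Real.norm_of_nonneg hκ, mul_left_comm,
        ← sq, ← Real.rpow_natCast, ← Real.rpow_mul hκ,
        ← Real.rpow_add_of_nonneg hκ (by linarith) (by simp)]
      congr 1; push_cast; ring
    rw [h2]
    exact mul_le_mul hdimle h1 (integral_nonneg fun y => by positivity) hκ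
  · intro hL
    have : 0 < κ := lt_of_lt_of_le (by positivity) hdimle
    rw [Pi.mul_apply, norm_mul, hdiag, Complex.norm_real, Real.norm_of_nonneg hκ]
    positivity

/-! ### A Bernstein type inequality for vector valued polynomials -/

section VectorPolynomial

variable {E : Type*} [NormedAddCommGroup E] [NormedSpace ℂ E]

lemma norm_sum_pow_smul_le_of_norm_le_one {q : ℕ → E} {n : ℕ} {B : ℝ}
    (hB : ∀ ζ : ℂ, ‖ζ‖ = 1 → ‖∑ m ∈ Finset.range n, ζ ^ m • q m‖ ≤ B) {ζ : ℂ} (hζ : ‖ζ‖ ≤ 1) :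
    ‖∑ m ∈ Finset.range n, ζ ^ m • q m‖ ≤ B := by
  have hd : Differentiable ℂ fun ζ : ℂ => ∑ m ∈ Finset.range n, ζ ^ m • q m := by fun_prop
  refine Complex.norm_le_of_forall_mem_frontier_norm_le (U := Metric.ball (0 : ℂ) 1)
    Metric.isBounded_ball hd.diffContOnCl (fun z hz => hB z ?_) ?_
  · rw [frontier_ball _ one_ne_zero] at hz
    simpa using hz
  · rw [closure_ball _ one_ne_zero]
    simpa using hζ

/-- Outside the disc, write P(ζ) = ζ^D P*(1/ζ) with P* the polynomial with reversed coefficients. P*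
obeys the same bound on the circle, hence by the maximum principle at 1/ζ. -/
lemma norm_sum_pow_smul_le {q : ℕ → E} {D : ℕ} {B : ℝ}
    (hB : ∀ ζ : ℂ, ‖ζ‖ = 1 → ‖∑ m ∈ Finset.range (D + 1), ζ ^ m • q m‖ ≤ B) {ζ : ℂ} {r : ℝ}
    (hr : 1 ≤ r) (hζ : ‖ζ‖ ≤ r) :
    ‖∑ m ∈ Finset.range (D + 1), ζ ^ m • q m‖ ≤ r ^ D * B := by
  have hB0 : 0 ≤ B := (norm_nonneg _).trans (hB 1 norm_one)
  rcases le_or_gt ‖ζ‖ 1 with h1 | h1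
  · exact (norm_sum_pow_smul_le_of_norm_le_one hB h1).trans
      (le_mul_of_one_le_left hB0 (one_le_pow₀ hr))
  · have hrev : ∀ z : ℂ, z ≠ 0 → ∑ m ∈ Finset.range (D + 1), z ^ m • q m =
        z ^ D • ∑ m ∈ Finset.range (D + 1), z⁻¹ ^ m • q (D - m) := by
      intro z hz
      rw [← Finset.sum_range_reflect, Finset.smul_sum]
      refine Finset.sum_congr rfl fun m hm => ?_
      have hm' : m ≤ D := Nat.lt_succ_iff.mp (Finset.mem_range.mp hm)
      rw [smul_smul, show D + 1 - 1 - m = D - m by omega, inv_pow, ← pow_sub₀ z hz hm']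
    have hz0 : ζ ≠ 0 := norm_pos_iff.mp (zero_lt_one.trans h1)
    have hB' : ∀ z : ℂ, ‖z‖ = 1 →
        ‖∑ m ∈ Finset.range (D + 1), z ^ m • q (D - m)‖ ≤ B := by
      intro z hz
      have hz0' : z ≠ 0 := norm_pos_iff.mp (hz ▸ zero_lt_one)
      have h := hrev z⁻¹ (inv_ne_zero hz0')
      rw [inv_inv] at h
      have h2 := hB z⁻¹ (by rw [norm_inv, hz, inv_one])
      rwa [h, norm_smul, norm_pow, norm_inv, hz, inv_one, one_pow, one_mul] at h2
    rw [hrev ζ hz0, norm_smul, norm_pow]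
    have h3 := norm_sum_pow_smul_le_of_norm_le_one hB' (ζ := ζ⁻¹)
      (by rw [norm_inv]; exact inv_le_one_of_one_le₀ h1.le)
    gcongr

/-- The sum is the k-th Taylor coefficient at 1. Cauchy's estimate on the circle of radius r about 1
applies, as this circle lies in |ζ| ≤ 1 + r. -/
lemma norm_sum_choose_smul_le [CompleteSpace E] {q : ℕ → E} {D : ℕ} {B : ℝ}
    (hB : ∀ ζ : ℂ, ‖ζ‖ = 1 → ‖∑ m ∈ Finset.range (D + 1), ζ ^ m • q m‖ ≤ B) {r : ℝ}
    (hr : 0 < r) (k : ℕ) :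
    ‖∑ m ∈ Finset.range (D + 1), (m.choose k : ℂ) • q m‖ ≤ (1 + r) ^ D * B / r ^ k := by
  have hd : Differentiable ℂ fun ζ : ℂ => ∑ m ∈ Finset.range (D + 1), ζ ^ m • q m := by fun_prop
  have h := Complex.norm_iteratedDeriv_le_of_forall_mem_sphere_norm_le (c := 1) k hr
    hd.diffContOnCl (C := (1 + r) ^ D * B) fun z hz => norm_sum_pow_smul_le hB (by linarith) ?_
  · have hder : iteratedDeriv k (fun ζ : ℂ => ∑ m ∈ Finset.range (D + 1), ζ ^ m • q m) 1 =
        (k.factorial : ℂ) • ∑ m ∈ Finset.range (D + 1), (m.choose k : ℂ) • q m := by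
      rw [iteratedDeriv_fun_sum fun i _ => by fun_prop, Finset.smul_sum]
      refine Finset.sum_congr rfl fun m _ => ?_
      rw [iteratedDeriv_smul_const (by fun_prop), iteratedDeriv_pow, one_pow, mul_one, smul_smul,
        Nat.descFactorial_eq_factorial_mul_choose]
      push_cast; rfl
    rw [hder, norm_smul, Complex.norm_natCast, mul_div_assoc] at h
    exact le_of_mul_le_mul_left h (by positivity)
  · rw [mem_sphere_iff_norm] at hz
    calc ‖z‖ = ‖1 + (z - 1)‖ := by ring_nf
      _ ≤ ‖(1 : ℂ)‖ + ‖z - 1‖ := norm_add_le _ _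
      _ = 1 + r := by rw [norm_one, hz]

end VectorPolynomial

/-! ### Norms on `Π_L` -/

/-- The `L^p` norm with respect to the surface measure. -/
noncomputable def lpNormSph (p : ℝ≥0∞) (f : Sph d → ℂ) : ℝ :=
  (eLpNorm f p (surfaceMeasure d)).toReal

lemma lpNormSph_nonneg (p : ℝ≥0∞) (f : Sph d → ℂ) : 0 ≤ lpNormSph p f := ENNReal.toReal_nonneg

lemma lpNormSph_smul (p : ℝ≥0∞) (c : ℂ) (f : Sph d → ℂ) :
    lpNormSph p (c • f) = ‖c‖ * lpNormSph p f := by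
  rw [lpNormSph, eLpNorm_const_smul, ENNReal.toReal_mul, toReal_enorm, lpNormSph]

lemma lpNormSph_comp_sphereMap (p : ℝ≥0∞) {f : Sph d → ℂ} (hf : Continuous f)
    (A : EuclideanSpace ℝ (Fin (d + 1)) ≃ₗᵢ[ℝ] EuclideanSpace ℝ (Fin (d + 1))) :
    lpNormSph p (f ∘ sphereMap A) = lpNormSph p f := by
  rw [lpNormSph, eLpNorm_comp_measurePreserving hf.aestronglyMeasurable
    (measurePreserving_sphereMap A), lpNormSph]

/-- Makes the L^p norm on Π_L the norm of a complete space, where the vector valued estimates above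
apply. -/
lemma exists_toLp (p : ℝ≥0∞) [Fact (1 ≤ p)] (d L : ℕ) :
    ∃ T : harmonicsUpTo d L →ₗ[ℂ] Lp ℂ p (surfaceMeasure d), ∀ f, ‖T f‖ = lpNormSph p f.1 := by
  let T₀ : harmonicsUpTo d L →ₗ[ℂ] C(Sph d, ℂ) :=
    { toFun := fun f => ⟨f.1, continuous_of_mem_harmonicsUpTo f.2⟩
      map_add' := fun _ _ => rfl
      map_smul' := fun _ _ => rfl }
  refine ⟨(ContinuousMap.toLp p (surfaceMeasure d) ℂ).toLinearMap ∘ₗ T₀, fun f => ?_⟩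
  rw [Lp.norm_def, lpNormSph]
  congr 1
  exact eLpNorm_congr_ae (ContinuousMap.coeFn_toLp (surfaceMeasure d) (T₀ f))

/-- Bounds for the Taylor coefficients at `1` of a polynomial with values in `Π_L`. -/
lemma lpNormSph_sum_choose_smul_le (p : ℝ≥0∞) [Fact (1 ≤ p)] {L D : ℕ} {q : ℕ → Sph d → ℂ}
    (hq : ∀ m, q m ∈ harmonicsUpTo d L) {B : ℝ}
    (hB : ∀ ζ : ℂ, ‖ζ‖ = 1 → lpNormSph p (∑ m ∈ Finset.range (D + 1), ζ ^ m • q m) ≤ B) {r : ℝ}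
    (hr : 0 < r) (k : ℕ) :
    lpNormSph p (∑ m ∈ Finset.range (D + 1), (m.choose k : ℂ) • q m) ≤
      (1 + r) ^ D * B / r ^ k := by
  obtain ⟨T, hT⟩ := exists_toLp p d L
  have key : ∀ a : ℕ → ℂ, ‖∑ m ∈ Finset.range (D + 1), a m • T ⟨q m, hq m⟩‖ =
      lpNormSph p (∑ m ∈ Finset.range (D + 1), a m • q m) := by
    intro a
    have : ∑ m ∈ Finset.range (D + 1), a m • T ⟨q m, hq m⟩ =
        T (∑ m ∈ Finset.range (D + 1), a m • ⟨q m, hq m⟩) := by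
      simp only [map_sum, map_smul]
    rw [this, hT]
    congr 1
    simp
  rw [← key]
  refine norm_sum_choose_smul_le (q := fun m => T ⟨q m, hq m⟩) (fun ζ hζ => ?_) hr k
  rw [key]
  exact hB ζ hζ

/-! ### Plane rotations -/

/-- `y` is obtained from `x` by the rotation of the plane of the coordinates `p` and `i` which is
the multiplication by the complex number `ζ`. -/
def PlaneRot (i p : Fin (d + 1)) (ζ : ℂ) (x y : Sph d) : Prop :=
  (⟨(y : EuclideanSpace ℝ (Fin (d + 1))) p, (y : EuclideanSpace ℝ (Fin (d + 1))) i⟩ : ℂ) =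
      ζ * ⟨(x : EuclideanSpace ℝ (Fin (d + 1))) p, (x : EuclideanSpace ℝ (Fin (d + 1))) i⟩ ∧
    ∀ j, j ≠ i → j ≠ p →
      (y : EuclideanSpace ℝ (Fin (d + 1))) j = (x : EuclideanSpace ℝ (Fin (d + 1))) j

lemma planeRot_one (i p : Fin (d + 1)) (x : Sph d) : PlaneRot i p 1 x x :=
  ⟨by rw [one_mul], fun _ _ _ => rfl⟩

lemma exists_sphereMap_planeRot {i p : Fin (d + 1)} (hip : i ≠ p) {ζ : ℂ} (hζ : ‖ζ‖ = 1) :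
    ∃ A : EuclideanSpace ℝ (Fin (d + 1)) ≃ₗᵢ[ℝ] EuclideanSpace ℝ (Fin (d + 1)),
      ∀ x, PlaneRot i p ζ x (sphereMap A x) := by
  let f : EuclideanSpace ℝ (Fin (d + 1)) → Fin (d + 1) → ℝ := fun x j =>
    if j = p then ζ.re * x p - ζ.im * x i else if j = i then ζ.re * x i + ζ.im * x p else x j
  have hfp : ∀ x, f x p = ζ.re * x p - ζ.im * x i := fun x => if_pos rfl
  have hfi : ∀ x, f x i = ζ.re * x i + ζ.im * x p := fun x =>
    (if_neg hip).trans (if_pos rfl)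
  have hfj : ∀ x j, j ≠ i → j ≠ p → f x j = x j := fun x j h1 h2 =>
    (if_neg h2).trans (if_neg h1)
  have hζ2 : ζ.re ^ 2 + ζ.im ^ 2 = 1 := by
    have := Complex.sq_norm ζ
    rw [hζ, Complex.normSq_apply] at this
    linarith
  let T : EuclideanSpace ℝ (Fin (d + 1)) →ₗ[ℝ] EuclideanSpace ℝ (Fin (d + 1)) :=
    { toFun := fun x => WithLp.toLp 2 (f x)
      map_add' := fun x y => by
        ext j
        simp only [f, PiLp.add_apply]
        split_ifs <;> ring
      map_smul' := fun c x => by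
        ext j
        simp only [f, PiLp.smul_apply, smul_eq_mul, RingHom.id_apply]
        split_ifs <;> ring }
  have hT : ∀ x, ‖T x‖ = ‖x‖ := by
    intro x
    rw [← sq_eq_sq₀ (norm_nonneg _) (norm_nonneg _), EuclideanSpace.real_norm_sq_eq,
      EuclideanSpace.real_norm_sq_eq]
    have hsplit : ∀ g : Fin (d + 1) → ℝ, ∑ j, g j =
        g p + (g i + ∑ j ∈ (Finset.univ.erase p).erase i, g j) := by
      intro g
      rw [Finset.add_sum_erase _ _ (by simp [hip]), Finset.add_sum_erase _ _ (by simp)]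
    rw [hsplit, hsplit]
    have hrest : ∑ j ∈ (Finset.univ.erase p).erase i, T x j ^ 2 =
        ∑ j ∈ (Finset.univ.erase p).erase i, x j ^ 2 := by
      refine Finset.sum_congr rfl fun j hj => ?_
      simp only [Finset.mem_erase, Finset.mem_univ, and_true] at hj
      change f x j ^ 2 = _
      rw [hfj x j hj.1 hj.2]
    rw [hrest]
    change f x p ^ 2 + (f x i ^ 2 + _) = _
    rw [hfp, hfi]
    linear_combination (x p ^ 2 + x i ^ 2) * hζ2
  let A := (LinearIsometry.mk T hT).toLinearIsometryEquiv rfl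
  have hA : ∀ x j, A x j = f x j := fun x j => rfl
  refine ⟨A, fun x => ⟨?_, fun j h1 h2 => ?_⟩⟩
  · apply Complex.ext
    · change A x p = _
      rw [hA, hfp]; simp
    · change A x i = _
      rw [hA, hfi]; simp
  · change A x j = _
    rw [hA, hfj _ _ h1 h2]

/-- The Fourier expansion of functions in `Π_L` along plane rotations. -/
lemma exists_fourier_planeRot {i p : Fin (d + 1)} (hip : i ≠ p) {f : Sph d → ℂ} {L : ℕ}
    (hf : f ∈ harmonicsUpTo d L) :
    ∃ q : ℕ → Sph d → ℂ, (∀ m, q m ∈ harmonicsUpTo d L) ∧ ∀ ζ : ℂ, ‖ζ‖ = 1 →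
      ∀ x y, PlaneRot i p ζ x y → ζ ^ L * f y = ∑ m ∈ Finset.range (2 * L + 1), ζ ^ m * q m x := by
  suffices h : ∃ F : Polynomial (Sph d → ℂ), F.natDegree ≤ 2 * L ∧
      (∀ m, F.coeff m ∈ harmonicsUpTo d L) ∧ ∀ ζ : ℂ, ‖ζ‖ = 1 →
      ∀ x y, PlaneRot i p ζ x y → ζ ^ L * f y = F.eval (fun _ => ζ) x by
    obtain ⟨F, hdeg, hF, h⟩ := h
    refine ⟨F.coeff, hF, fun ζ hζ x y hxy => ?_⟩
    rw [h ζ hζ x y hxy, Polynomial.eval_eq_sum_range' (Nat.lt_succ_of_le hdeg), Finset.sum_apply]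
    exact Finset.sum_congr rfl fun m _ => mul_comm _ _
  refine harmonicsUpTo_induction (P := fun L f => ∃ F : Polynomial (Sph d → ℂ),
    F.natDegree ≤ 2 * L ∧ (∀ m, F.coeff m ∈ harmonicsUpTo d L) ∧ ∀ ζ : ℂ, ‖ζ‖ = 1 →
      ∀ x y, PlaneRot i p ζ x y → ζ ^ L * f y = F.eval (fun _ => ζ) x) ?_ ?_ ?_ hf
  · intro c L
    refine ⟨Polynomial.C (fun _ => c) * Polynomial.X ^ L,
      (Polynomial.natDegree_C_mul_X_pow_le _ _).trans (by omega), fun m => ?_, fun ζ _ x y _ => ?_⟩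
    · rw [Polynomial.coeff_C_mul_X_pow]
      split_ifs
      · exact const_mem_harmonicsUpTo c L
      · exact zero_mem _
    · rw [Polynomial.eval_mul, Polynomial.eval_C, Polynomial.eval_pow, Polynomial.eval_X,
        Pi.mul_apply, Pi.pow_apply, mul_comm]
  · rintro L f g ⟨F, hF, hF', hF''⟩ ⟨G, hG, hG', hG''⟩
    refine ⟨F + G, Polynomial.natDegree_add_le_of_degree_le hF hG, fun m => ?_,
      fun ζ hζ x y h => ?_⟩
    · rw [Polynomial.coeff_add]; exact add_mem (hF' m) (hG' m)
    · rw [Pi.add_apply, mul_add, hF'' ζ hζ x y h, hG'' ζ hζ x y h, Polynomial.eval_add,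
        Pi.add_apply]
  · rintro L f k ⟨F, hF, hF', hF''⟩
    -- The rotation multiplies x_p + i x_i by ζ and its conjugate by ζ⁻¹. One factor ζ clears the
    -- inverse, leaving a quadratic polynomial in ζ; hence ζ^L and the degree 2L.
    obtain ⟨a, ha, hak⟩ : ∃ a : Fin 3 → Sph d → ℂ, (∀ m, a m ∈ harmonicsUpTo d 1) ∧
        ∀ ζ : ℂ, ‖ζ‖ = 1 → ∀ x y, PlaneRot i p ζ x y →
          ζ * (((y : EuclideanSpace ℝ (Fin (d + 1))) k : ℝ) : ℂ) =
            a 0 x + a 1 x * ζ + a 2 x * ζ ^ 2 := by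
      let X : Fin (d + 1) → Sph d → ℂ :=
        fun j x => (((x : EuclideanSpace ℝ (Fin (d + 1))) j : ℝ) : ℂ)
      have hX : ∀ j, X j ∈ harmonicsUpTo d 1 := coord_mem_harmonicsUpTo
      have hre : ∀ ζ : ℂ, ‖ζ‖ = 1 → ∀ x y, PlaneRot i p ζ x y →
          X p y + X i y * Complex.I = ζ * (X p x + X i x * Complex.I) ∧
          ζ * (X p y - X i y * Complex.I) = X p x - X i x * Complex.I := by
        intro ζ hζ x y h
        have h1 := h.1
        rw [Complex.mk_eq_add_mul_I, Complex.mk_eq_add_mul_I] at h1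
        refine ⟨h1, ?_⟩
        have h2 := congrArg (starRingEnd ℂ) h1
        simp only [map_add, map_mul, Complex.conj_ofReal, Complex.conj_I] at h2
        have h3 : ζ * starRingEnd ℂ ζ = 1 := by
          rw [Complex.mul_conj', hζ]; norm_num
        simp only [X]
        linear_combination ζ * h2 + ((((x : EuclideanSpace ℝ (Fin (d + 1))) p : ℝ) : ℂ) -
          (((x : EuclideanSpace ℝ (Fin (d + 1))) i : ℝ) : ℂ) * Complex.I) * h3
      have hw : X p + Complex.I • X i ∈ harmonicsUpTo d 1 :=
        add_mem (hX p) (Submodule.smul_mem _ _ (hX i))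
      have hw' : X p - Complex.I • X i ∈ harmonicsUpTo d 1 :=
        sub_mem (hX p) (Submodule.smul_mem _ _ (hX i))
      by_cases hkp : k = p
      · subst hkp
        refine ⟨![(1 / 2 : ℂ) • (X k - Complex.I • X i), 0, (1 / 2 : ℂ) • (X k + Complex.I • X i)],
          fun m => ?_, fun ζ hζ x y h => ?_⟩
        · fin_cases m
          exacts [Submodule.smul_mem _ _ hw', zero_mem _, Submodule.smul_mem _ _ hw]
        · obtain ⟨h1, h2⟩ := hre ζ hζ x y h
          change ζ * X k y = (1 / 2 : ℂ) * (X k x - Complex.I * X i x) + 0 * ζ +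
            (1 / 2 : ℂ) * (X k x + Complex.I * X i x) * ζ ^ 2
          linear_combination (1 / 2 : ℂ) * ζ * h1 + (1 / 2 : ℂ) * h2
      · by_cases hki : k = i
        · subst hki
          refine ⟨![(Complex.I / 2 : ℂ) • (X p - Complex.I • X k), 0,
            (-Complex.I / 2 : ℂ) • (X p + Complex.I • X k)],
            fun m => ?_, fun ζ hζ x y h => ?_⟩
          · fin_cases m
            exacts [Submodule.smul_mem _ _ hw', zero_mem _, Submodule.smul_mem _ _ hw]
          · obtain ⟨h1, h2⟩ := hre ζ hζ x y h
            change ζ * X k y = (Complex.I / 2 : ℂ) * (X p x - Complex.I * X k x) + 0 * ζ +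
              (-Complex.I / 2 : ℂ) * (X p x + Complex.I * X k x) * ζ ^ 2
            linear_combination (-Complex.I / 2 : ℂ) * ζ * h1 + (Complex.I / 2 : ℂ) * h2 +
              ζ * X k y * Complex.I_sq
        · refine ⟨![0, X k, 0], fun m => ?_, fun ζ hζ x y h => ?_⟩
          · fin_cases m
            exacts [zero_mem _, hX k, zero_mem _]
          · change ζ * X k y = 0 + X k x * ζ + 0 * ζ ^ 2
            have : X k y = X k x := congrArg Complex.ofReal (h.2 k hki hkp)
            rw [this]; ring
    refine ⟨F * Polynomial.C (a 0) + F * Polynomial.C (a 1) * Polynomial.X ^ 1 +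
      F * Polynomial.C (a 2) * Polynomial.X ^ 2, ?_, fun m => ?_, fun ζ hζ x y h => ?_⟩
    · have h0 : ∀ (b : Sph d → ℂ) (n : ℕ), n ≤ 2 →
          (F * Polynomial.C b * Polynomial.X ^ n).natDegree ≤ 2 * (L + 1) := by
        intro b n hn
        have h1 := Polynomial.natDegree_mul_le (p := F * Polynomial.C b) (q := Polynomial.X ^ n)
        have h2 := Polynomial.natDegree_mul_C_le F b
        have h3 := Polynomial.natDegree_X_pow_le (R := Sph d → ℂ) n
        omega
      have h00 := h0 (a 0) 0 (by omega)
      rw [pow_zero, mul_one] at h00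
      exact Polynomial.natDegree_add_le_of_degree_le
        (Polynomial.natDegree_add_le_of_degree_le h00 (h0 _ 1 (by omega))) (h0 _ 2 le_rfl)
    · have hm : ∀ m j, F.coeff m * a j ∈ harmonicsUpTo d (L + 1) :=
        fun m j => mul_mem_harmonicsUpTo (hF' m) (ha j)
      simp only [Polynomial.coeff_add, Polynomial.coeff_mul_X_pow', Polynomial.coeff_mul_C]
      refine add_mem (add_mem (hm _ _) ?_) ?_
      all_goals
        split_ifs
        · exact hm _ _
        · exact zero_mem _
    · have e1 := hF'' ζ hζ x y h
      have e2 := hak ζ hζ x y h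
      simp only [Polynomial.eval_add, Polynomial.eval_mul, Polynomial.eval_C, Polynomial.eval_pow,
        Polynomial.eval_X, Pi.add_apply, Pi.mul_apply, Pi.pow_apply]
      rw [← e1, pow_succ, mul_mul_mul_comm, e2]
      ring

/-! ### Controlled relations -/

/-- The increments of functions `f ∈ Π_L` along the relation `r` are bounded by a sum of moduli of
functions in `Π_L` with small `L^p` norms. -/
def Controlled (p : ℝ≥0∞) (L : ℕ) (c : ℝ) (r : Sph d → Sph d → Prop) : Prop :=
  ∀ f ∈ harmonicsUpTo d L, ∃ (ι : Type) (_ : Fintype ι) (g : ι → Sph d → ℂ),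
    (∀ i, g i ∈ harmonicsUpTo d L) ∧ (∀ x y, r x y → ‖f y - f x‖ ≤ ∑ i, ‖g i x‖) ∧
    ∑ i, lpNormSph p (g i) ≤ c * lpNormSph p f

namespace Controlled

variable {p : ℝ≥0∞} {L : ℕ} {c c' : ℝ} {r r' : Sph d → Sph d → Prop}

lemma mono (h : Controlled p L c r) (hc : c ≤ c') (hr : ∀ x y, r' x y → r x y) :
    Controlled p L c' r' := by
  intro f hf
  obtain ⟨ι, _, g, hg, hle, hsum⟩ := h f hf
  exact ⟨ι, _, g, hg, fun x y hxy => hle x y (hr x y hxy),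
    hsum.trans (mul_le_mul_of_nonneg_right hc (lpNormSph_nonneg _ _))⟩

lemma eq : Controlled p L 0 (d := d) Eq := by
  intro f _
  refine ⟨Empty, inferInstance, fun e => e.elim, fun e => e.elim, ?_, by simp⟩
  rintro x _ rfl
  simp

/-- Going from x to w to y, the functions k bounding the second increment are evaluated at w; the
first relation, applied to each k, brings them back to x. The constant is (1 + c)(1 + c') - 1. -/
lemma comp (hc : 0 ≤ c) (h : Controlled p L c r) (h' : Controlled p L c' r') :
    Controlled p L (c + c' * (1 + c)) (Relation.Comp r r') := by
  intro f hf
  obtain ⟨ι, _, g, hg, hle, hsum⟩ := h f hf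
  obtain ⟨κ, _, k, hk, hle', hsum'⟩ := h' f hf
  choose η hη e he hele hesum using fun i => h (k i) (hk i)
  refine ⟨ι ⊕ (κ ⊕ Σ i, η i), inferInstance,
    Sum.elim g (Sum.elim k fun s => e s.1 s.2), ?_, ?_, ?_⟩
  · rintro (i | i | i)
    exacts [hg i, hk i, he _ _]
  · rintro x y ⟨w, hxw, hwy⟩
    simp only [Fintype.sum_sum_type, Sum.elim_inl, Sum.elim_inr, Fintype.sum_sigma]
    calc ‖f y - f x‖ = ‖(f w - f x) + (f y - f w)‖ := by ring_nf
      _ ≤ ‖f w - f x‖ + ‖f y - f w‖ := norm_add_le _ _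
      _ ≤ ∑ i, ‖g i x‖ + ∑ i, ‖k i w‖ := add_le_add (hle _ _ hxw) (hle' _ _ hwy)
      _ ≤ ∑ i, ‖g i x‖ + ∑ i, (‖k i x‖ + ∑ j, ‖e i j x‖) := by
        gcongr with i
        calc ‖k i w‖ = ‖k i x + (k i w - k i x)‖ := by ring_nf
          _ ≤ _ := (norm_add_le _ _).trans (add_le_add le_rfl (hele i _ _ hxw))
      _ = _ := by rw [Finset.sum_add_distrib]
  · simp only [Fintype.sum_sum_type, Sum.elim_inl, Sum.elim_inr, Fintype.sum_sigma]
    calc _ ≤ c * lpNormSph p f + (∑ i, lpNormSph p (k i) + ∑ i, c * lpNormSph p (k i)) := by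
          gcongr with i
          exact hesum i
      _ = c * lpNormSph p f + (1 + c) * ∑ i, lpNormSph p (k i) := by
          rw [← Finset.mul_sum]; ring
      _ ≤ c * lpNormSph p f + (1 + c) * (c' * lpNormSph p f) := by gcongr
      _ = _ := by ring

lemma iUnion {ι : Type} [Fintype ι] {c : ι → ℝ} {r : ι → Sph d → Sph d → Prop}
    (h : ∀ i, Controlled p L (c i) (r i)) :
    Controlled p L (∑ i, c i) fun x y => ∃ i, r i x y := by
  intro f hf
  choose η hη e he hele hesum using fun i => h i f hf
  refine ⟨Σ i, η i, inferInstance, fun s => e s.1 s.2, fun s => he _ _, ?_, ?_⟩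
  · rintro x y ⟨i, hi⟩
    rw [Fintype.sum_sigma]
    exact (hele i x y hi).trans (Finset.single_le_sum (f := fun i => ∑ j, ‖e i j x‖)
      (fun _ _ => Finset.sum_nonneg fun _ _ => norm_nonneg _) (Finset.mem_univ i))
  · rw [Fintype.sum_sigma, Finset.sum_mul]
    exact Finset.sum_le_sum fun i _ => hesum i

end Controlled

/-- Points joined by a small rotation in the plane of two coordinates. -/
def SmallRot (i p : Fin (d + 1)) (δ : ℝ) (x y : Sph d) : Prop :=
  ∃ ζ : ℂ, ‖ζ‖ = 1 ∧ ‖ζ - 1‖ ≤ δ ∧ PlaneRot i p ζ x y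

lemma norm_one_sub_pow_le {ζ : ℂ} (hζ : ‖ζ‖ = 1) (L : ℕ) : ‖1 - ζ ^ L‖ ≤ L * ‖ζ - 1‖ := by
  induction L with
  | zero => simp
  | succ L ih =>
    calc ‖1 - ζ ^ (L + 1)‖ = ‖(1 - ζ ^ L) - ζ ^ L * (ζ - 1)‖ := by ring_nf
      _ ≤ ‖1 - ζ ^ L‖ + ‖ζ ^ L * (ζ - 1)‖ := norm_sub_le _ _
      _ ≤ L * ‖ζ - 1‖ + ‖ζ - 1‖ := by
        rw [norm_mul, norm_pow, hζ, one_pow, one_mul]; gcongr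
      _ = _ := by push_cast; ring

lemma one_add_inv_pow_le (L : ℕ) : (1 + 1 / ((L : ℝ) + 1)) ^ (2 * L) ≤ Real.exp 2 := by
  have h : (1 + 1 / ((L : ℝ) + 1)) ≤ Real.exp (1 / ((L : ℝ) + 1)) := by
    rw [add_comm]; exact Real.add_one_le_exp _
  calc _ ≤ Real.exp (1 / ((L : ℝ) + 1)) ^ (2 * L) := by gcongr
    _ = Real.exp ((2 * L : ℕ) * (1 / ((L : ℝ) + 1))) := (Real.exp_nat_mul _ _).symm
    _ ≤ Real.exp 2 := by
      gcongr
      push_cast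
      rw [mul_one_div, div_le_iff₀ (by positivity)]
      linarith

/-- Small rotations are controlled. -/
theorem controlled_smallRot (p : ℝ≥0∞) [Fact (1 ≤ p)] {i j : Fin (d + 1)} (hij : i ≠ j) (L : ℕ)
    {ε : ℝ} (hε : 0 ≤ ε) (hε' : ε ≤ 1 / 2) :
    Controlled p L ((1 + 2 * Real.exp 2) * ε) (SmallRot i j (ε / (L + 1))) := by
  intro f hf
  obtain ⟨q, hq, hexp⟩ := exists_fourier_planeRot hij hf
  have hL : (0 : ℝ) < L + 1 := by positivity
  set δ : ℝ := ε / (L + 1) with hδ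
  have hδ0 : 0 ≤ δ := by positivity
  -- Taylor coefficients at ζ = 1 of ζ^L f(y), as functions of x.
  let g : ℕ → Sph d → ℂ := fun k => ∑ m ∈ Finset.range (2 * L + 1), (m.choose k : ℂ) • q m
  have hg : ∀ k, g k ∈ harmonicsUpTo d L := fun k =>
    sum_mem fun m _ => Submodule.smul_mem _ _ (hq m)
  have hgnorm : ∀ k, lpNormSph p (g k) ≤ Real.exp 2 * lpNormSph p f * ((L : ℝ) + 1) ^ k := by
    intro k
    have hB : ∀ ζ : ℂ, ‖ζ‖ = 1 →
        lpNormSph p (∑ m ∈ Finset.range (2 * L + 1), ζ ^ m • q m) ≤ lpNormSph p f := by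
      intro ζ hζ
      obtain ⟨A, hA⟩ := exists_sphereMap_planeRot hij hζ
      have : ∑ m ∈ Finset.range (2 * L + 1), ζ ^ m • q m = ζ ^ L • (f ∘ sphereMap A) := by
        ext x
        rw [Pi.smul_apply, smul_eq_mul, Function.comp_apply, hexp ζ hζ x _ (hA x),
          Finset.sum_apply]
        rfl
      rw [this, lpNormSph_smul, norm_pow, hζ, one_pow, one_mul,
        lpNormSph_comp_sphereMap p (continuous_of_mem_harmonicsUpTo hf)]
    -- The radius 1/(L+1) keeps (1 + r)^(2L) below e² and costs a factor L + 1 for each order.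
    refine (lpNormSph_sum_choose_smul_le p hq hB (r := 1 / ((L : ℝ) + 1)) (by positivity) k).trans
      ?_
    rw [one_div_pow, div_div_eq_mul_div, div_one]
    have := one_add_inv_pow_le L
    have := lpNormSph_nonneg p f
    gcongr
  have hg0 : ∀ x, f x = g 0 x := by
    intro x
    have := hexp 1 norm_one x x (planeRot_one i j x)
    simpa [g] using this
  have htaylor : ∀ (ζ : ℂ) (x : Sph d), ∑ m ∈ Finset.range (2 * L + 1), ζ ^ m * q m x =
      ∑ k ∈ Finset.range (2 * L + 1), (ζ - 1) ^ k * g k x := by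
    intro ζ x
    have hz : ∀ m ∈ Finset.range (2 * L + 1), ζ ^ m * q m x =
        ∑ k ∈ Finset.range (2 * L + 1), (ζ - 1) ^ k * ((m.choose k : ℂ) * q m x) := by
      intro m hm
      have h1 : ζ ^ m = ∑ k ∈ Finset.range (2 * L + 1), (ζ - 1) ^ k * (m.choose k : ℂ) := by
        conv_lhs => rw [← sub_add_cancel ζ 1, add_pow]
        simp only [one_pow, mul_one]
        refine Finset.sum_subset (fun k hk => ?_) fun k _ hk => ?_
        · rw [Finset.mem_range] at *; omega
        · rw [Finset.mem_range] at hk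
          rw [Nat.choose_eq_zero_of_lt (by omega), Nat.cast_zero, mul_zero]
      rw [h1, Finset.sum_mul]
      exact Finset.sum_congr rfl fun k _ => mul_assoc _ _ _
    rw [Finset.sum_congr rfl hz, Finset.sum_comm]
    refine Finset.sum_congr rfl fun k _ => ?_
    rw [← Finset.mul_sum]
    simp [g]
  -- The term L δ f pays for the factor ζ^L, as ζ^L (f y - f x) = (1 - ζ^L) f x + (ζ^L f y - f x).
  -- The others are the Taylor terms of order at least 1.
  refine ⟨Unit ⊕ Fin (2 * L), inferInstance, Sum.elim (fun _ => ((L * δ : ℝ) : ℂ) • f)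
    fun k => ((δ ^ (k.1 + 1) : ℝ) : ℂ) • g (k.1 + 1), ?_, ?_, ?_⟩
  · rintro (_ | k)
    exacts [Submodule.smul_mem _ _ hf, Submodule.smul_mem _ _ (hg _)]
  · rintro x y ⟨ζ, hζ, hζδ, hxy⟩
    simp only [Fintype.sum_sum_type, Sum.elim_inl, Sum.elim_inr, Finset.univ_unique,
      Finset.sum_singleton, Pi.smul_apply, smul_eq_mul, norm_mul, Complex.norm_real,
      Real.norm_eq_abs, Nat.abs_cast, abs_of_nonneg hδ0]
    have h1 : ζ ^ L * f y - f x = ∑ k ∈ Finset.range (2 * L), (ζ - 1) ^ (k + 1) * g (k + 1) x := by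
      rw [hexp ζ hζ x y hxy, htaylor, Finset.sum_range_succ', hg0 x]
      simp
    calc ‖f y - f x‖ = ‖ζ ^ L * (f y - f x)‖ := by
          rw [norm_mul, norm_pow, hζ, one_pow, one_mul]
      _ = ‖(1 - ζ ^ L) * f x + (ζ ^ L * f y - f x)‖ := by ring_nf
      _ ≤ ‖1 - ζ ^ L‖ * ‖f x‖ + ‖ζ ^ L * f y - f x‖ := by
          rw [← norm_mul]; exact norm_add_le _ _
      _ ≤ L * δ * ‖f x‖ + ∑ k ∈ Finset.range (2 * L), δ ^ (k + 1) * ‖g (k + 1) x‖ := by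
          rw [h1]
          refine add_le_add ?_ ((norm_sum_le _ _).trans (Finset.sum_le_sum fun k _ => ?_))
          · have := norm_one_sub_pow_le hζ L
            gcongr
            exact this.trans (by gcongr)
          · rw [norm_mul, norm_pow]
            gcongr
      _ = _ := by
          rw [Finset.sum_range fun k => δ ^ (k + 1) * ‖g (k + 1) x‖]
          congr 1
          exact Finset.sum_congr rfl fun k _ => by rw [abs_of_nonneg (by positivity)]
  · simp only [Fintype.sum_sum_type, Sum.elim_inl, Sum.elim_inr, Finset.univ_unique,
      Finset.sum_singleton, lpNormSph_smul, Complex.norm_real, Real.norm_eq_abs]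
    have hN := lpNormSph_nonneg p f
    have h1 : |L * δ| * lpNormSph p f ≤ ε * lpNormSph p f := by
      rw [abs_of_nonneg (by positivity)]
      gcongr
      rw [hδ, mul_div_assoc', div_le_iff₀ hL]
      nlinarith
    have h2 : ∀ k : Fin (2 * L), |δ ^ (k.1 + 1)| * lpNormSph p (g (k.1 + 1)) ≤
        Real.exp 2 * lpNormSph p f * ε * (1 / 2) ^ k.1 := by
      intro k
      rw [abs_of_nonneg (by positivity)]
      calc δ ^ (k.1 + 1) * lpNormSph p (g (k.1 + 1))
          ≤ δ ^ (k.1 + 1) * (Real.exp 2 * lpNormSph p f * ((L : ℝ) + 1) ^ (k.1 + 1)) := by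
            gcongr; exact hgnorm _
        _ = Real.exp 2 * lpNormSph p f * (δ * (L + 1)) ^ (k.1 + 1) := by rw [mul_pow]; ring
        _ = Real.exp 2 * lpNormSph p f * ε * ε ^ k.1 := by
            rw [hδ, div_mul_cancel₀ _ hL.ne', pow_succ]; ring
        _ ≤ _ := by gcongr
    -- Here ε ≤ 1/2 has made the Taylor series geometric with ratio 1/2, which yields the 2 in 1 +
    -- 2e².
    have h3 : ∑ k : Fin (2 * L), Real.exp 2 * lpNormSph p f * ε * (1 / 2 : ℝ) ^ k.1 ≤
        Real.exp 2 * lpNormSph p f * ε * 2 := by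
      rw [← Finset.mul_sum, ← Finset.sum_range fun k => (1 / 2 : ℝ) ^ k]
      gcongr
      exact sum_geometric_two_le _
    calc _ ≤ ε * lpNormSph p f + ∑ k : Fin (2 * L),
          Real.exp 2 * lpNormSph p f * ε * (1 / 2 : ℝ) ^ k.1 :=
          add_le_add h1 (Finset.sum_le_sum fun k _ => h2 k)
      _ ≤ ε * lpNormSph p f + Real.exp 2 * lpNormSph p f * ε * 2 := by gcongr
      _ = _ := by ring

/-! ### Close points are joined by small rotations -/

/-- The chord is at most the arc: |x - y|² = 2 - 2 cos θ ≤ θ². -/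
lemma abs_coord_sub_le_geodesicDist (x y : Sph d) (i : Fin (d + 1)) :
    |(x : EuclideanSpace ℝ (Fin (d + 1))) i - (y : EuclideanSpace ℝ (Fin (d + 1))) i| ≤
      geodesicDist x y := by
  have hx : ‖(x : EuclideanSpace ℝ (Fin (d + 1)))‖ = 1 := by simp
  have hy : ‖(y : EuclideanSpace ℝ (Fin (d + 1)))‖ = 1 := by simp
  have h0 : 0 ≤ geodesicDist x y := Real.arccos_nonneg _
  have habs := abs_real_inner_le_norm (x : EuclideanSpace ℝ (Fin (d + 1)))
    (y : EuclideanSpace ℝ (Fin (d + 1)))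
  rw [hx, hy, one_mul, abs_le] at habs
  have hcos : Real.cos (geodesicDist x y) = inner ℝ (x : EuclideanSpace ℝ (Fin (d + 1)))
      (y : EuclideanSpace ℝ (Fin (d + 1))) := Real.cos_arccos habs.1 habs.2
  have h1 := Real.one_sub_sq_div_two_le_cos (x := geodesicDist x y)
  have h2 := norm_sub_sq_real (x : EuclideanSpace ℝ (Fin (d + 1)))
    (y : EuclideanSpace ℝ (Fin (d + 1)))
  rw [hx, hy, ← hcos] at h2
  have h3 : ‖(x : EuclideanSpace ℝ (Fin (d + 1))) - (y : EuclideanSpace ℝ (Fin (d + 1)))‖ ≤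
      geodesicDist x y := by
    rw [← sq_le_sq₀ (norm_nonneg _) h0]; linarith
  exact (PiLp.norm_apply_le ((x : EuclideanSpace ℝ (Fin (d + 1))) -
    (y : EuclideanSpace ℝ (Fin (d + 1)))) i).trans h3

lemma abs_coord_le_one (x : Sph d) (i : Fin (d + 1)) :
    |(x : EuclideanSpace ℝ (Fin (d + 1))) i| ≤ 1 :=
  (PiLp.norm_apply_le (x : EuclideanSpace ℝ (Fin (d + 1))) i).trans (by simp)

/-- One coordinate of `x` is moved to a prescribed value by a small rotation. -/
lemma exists_smallRot {i p : Fin (d + 1)} (hip : i ≠ p) {c η : ℝ} (hc : 0 < c) (hc1 : c ≤ 1)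
    (x : Sph d) {b : ℝ} (hb : |b| ≤ 1)
    (hxb : |(x : EuclideanSpace ℝ (Fin (d + 1))) i - b| ≤ η)
    (hx : c ^ 2 + 2 * η ≤ (x : EuclideanSpace ℝ (Fin (d + 1))) p ^ 2) :
    ∃ w : Sph d, SmallRot i p (3 * η / c ^ 2) x w ∧
      (w : EuclideanSpace ℝ (Fin (d + 1))) i = b ∧
      (∀ j, j ≠ i → j ≠ p →
        (w : EuclideanSpace ℝ (Fin (d + 1))) j = (x : EuclideanSpace ℝ (Fin (d + 1))) j) ∧
      0 < (w : EuclideanSpace ℝ (Fin (d + 1))) p * (x : EuclideanSpace ℝ (Fin (d + 1))) p ∧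
      (x : EuclideanSpace ℝ (Fin (d + 1))) p ^ 2 - 2 * η ≤
        (w : EuclideanSpace ℝ (Fin (d + 1))) p ^ 2 := by
  have hη : 0 ≤ η := (abs_nonneg _).trans hxb
  set a := (x : EuclideanSpace ℝ (Fin (d + 1))) i with ha
  set s := (x : EuclideanSpace ℝ (Fin (d + 1))) p with hs
  have ha1 : |a| ≤ 1 := abs_coord_le_one x i
  have hdiff : |a ^ 2 - b ^ 2| ≤ 2 * η := by
    rw [sq_sub_sq, abs_mul]
    have : |a + b| ≤ 2 := (abs_add_le _ _).trans (by linarith)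
    gcongr
  have hdiff' := abs_le.mp hdiff
  have hs2 : 0 < s ^ 2 := by nlinarith
  have hs0 : s ≠ 0 := by rintro h; rw [h] at hs2; norm_num at hs2
  -- The new p-coordinate is s t: t > 0 keeps its sign, and (s t)² + b² = s² + a² keeps the point on
  -- the sphere.
  set t := Real.sqrt (1 + (a ^ 2 - b ^ 2) / s ^ 2) with ht
  have hrad : 0 < 1 + (a ^ 2 - b ^ 2) / s ^ 2 := by
    have : 1 + (a ^ 2 - b ^ 2) / s ^ 2 = (s ^ 2 + (a ^ 2 - b ^ 2)) / s ^ 2 := by field_simp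
    rw [this]
    apply div_pos _ hs2
    nlinarith
  have ht0 : 0 < t := Real.sqrt_pos.mpr hrad
  have hst : (s * t) ^ 2 = s ^ 2 + a ^ 2 - b ^ 2 := by
    rw [mul_pow, ht, Real.sq_sqrt hrad.le]; field_simp; ring
  let v : EuclideanSpace ℝ (Fin (d + 1)) :=
    WithLp.toLp 2 fun j => if j = p then s * t else if j = i then b else
      (x : EuclideanSpace ℝ (Fin (d + 1))) j
  have hvp : v p = s * t := if_pos rfl
  have hvi : v i = b := (if_neg hip).trans (if_pos rfl)
  have hvj : ∀ j, j ≠ i → j ≠ p → v j = (x : EuclideanSpace ℝ (Fin (d + 1))) j :=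
    fun j h1 h2 => (if_neg h2).trans (if_neg h1)
  have hv : ‖v‖ = 1 := by
    rw [← sq_eq_sq₀ (norm_nonneg _) zero_le_one, EuclideanSpace.real_norm_sq_eq, one_pow,
      ← sum_sq_coord x]
    have hsplit : ∀ g : Fin (d + 1) → ℝ, ∑ j, g j =
        g p + (g i + ∑ j ∈ (Finset.univ.erase p).erase i, g j) := by
      intro g
      rw [Finset.add_sum_erase _ _ (by simp [hip]), Finset.add_sum_erase _ _ (by simp)]
    rw [hsplit, hsplit, hvp, hvi, hst]
    have hrest : ∑ j ∈ (Finset.univ.erase p).erase i, v j ^ 2 =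
        ∑ j ∈ (Finset.univ.erase p).erase i, (x : EuclideanSpace ℝ (Fin (d + 1))) j ^ 2 := by
      refine Finset.sum_congr rfl fun j hj => ?_
      simp only [Finset.mem_erase, Finset.mem_univ, and_true] at hj
      rw [hvj j hj.1 hj.2]
    rw [hrest, ← ha, ← hs]
    ring
  let z : ℂ := ⟨s, a⟩
  let z' : ℂ := ⟨s * t, b⟩
  have hcs : c ≤ |s| := by
    rw [← abs_of_pos hc]
    exact sq_le_sq.mp (by linarith)
  have hcz : c ≤ ‖z‖ := hcs.trans (Complex.abs_re_le_norm z)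
  have hz0 : z ≠ 0 := norm_pos_iff.mp (hc.trans_le hcz)
  have hzz' : ‖z'‖ = ‖z‖ := by
    rw [← sq_eq_sq₀ (norm_nonneg _) (norm_nonneg _), Complex.sq_norm, Complex.sq_norm,
      Complex.normSq_apply, Complex.normSq_apply]
    change s * t * (s * t) + b * b = s * s + a * a
    linarith
  -- The difference of squares is divided by |s t + s| ≥ |s| ≥ c.
  have hstd : |s * t - s| ≤ 2 * η / c := by
    rw [le_div_iff₀ hc]
    calc |s * t - s| * c ≤ |s * t - s| * |s * t + s| := by
          gcongr
          rw [show s * t + s = s * (t + 1) by ring, abs_mul, abs_of_pos (by linarith : 0 < t + 1)]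
          nlinarith [abs_nonneg s]
      _ = |a ^ 2 - b ^ 2| := by
          rw [← abs_mul]; congr 1; linear_combination hst
      _ ≤ 2 * η := hdiff
  refine ⟨⟨v, by simpa using hv⟩, ⟨z' / z, ?_, ?_, ?_, hvj⟩, hvi, hvj, ?_, ?_⟩
  · rw [norm_div, hzz', div_self (norm_ne_zero_iff.mpr hz0)]
  · rw [div_sub_one hz0, norm_div, div_le_div_iff₀ (hc.trans_le hcz) (by positivity)]
    have h1 : ‖z' - z‖ ≤ 3 * η / c := by
      calc ‖z' - z‖ ≤ |(z' - z).re| + |(z' - z).im| := Complex.norm_le_abs_re_add_abs_im _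
        _ ≤ 2 * η / c + η / c := by
          refine add_le_add hstd ?_
          change |b - a| ≤ _
          rw [abs_sub_comm]
          exact hxb.trans (le_div_self hη hc hc1)
        _ = 3 * η / c := by ring
    calc ‖z' - z‖ * c ^ 2 ≤ 3 * η / c * c ^ 2 := by gcongr
      _ = 3 * η * c := by field_simp
      _ ≤ 3 * η * ‖z‖ := by gcongr
  · change (⟨v p, v i⟩ : ℂ) = z' / z * z
    rw [div_mul_cancel₀ _ hz0, hvp, hvi]
  · change 0 < v p * s
    rw [hvp, show s * t * s = s ^ 2 * t by ring]
    positivity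
  · change s ^ 2 - 2 * η ≤ v p ^ 2
    rw [hvp, hst]
    linarith

/-- The coordinates in s are corrected one at a time, each by a rotation against the pivot p. Each
step lowers x_p² by at most 2η, so the pivot stays away from 0 and keeps its sign. Once all other
coordinates agree, the norm and the sign determine the pivot. Composing relations multiplies the
factors 1 + κ. -/
lemma exists_controlled_pivot {q : ℝ≥0∞} {L : ℕ} {p : Fin (d + 1)} {c η κ : ℝ} (hc : 0 < c)
    (hc1 : c ≤ 1) (hη : 0 ≤ η) (hκ0 : 0 ≤ κ)
    (hκ : ∀ i, i ≠ p → Controlled q L κ (SmallRot i p (3 * η / c ^ 2)))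
    (s : Finset (Fin (d + 1))) (hps : p ∉ s) :
    ∃ r : Sph d → Sph d → Prop, Controlled q L ((1 + κ) ^ s.card - 1) r ∧ ∀ x y : Sph d,
      (∀ i, i ∉ s → i ≠ p →
        (x : EuclideanSpace ℝ (Fin (d + 1))) i = (y : EuclideanSpace ℝ (Fin (d + 1))) i) →
      (∀ i, i ≠ p → |(x : EuclideanSpace ℝ (Fin (d + 1))) i -
        (y : EuclideanSpace ℝ (Fin (d + 1))) i| ≤ η) →
      0 < (x : EuclideanSpace ℝ (Fin (d + 1))) p * (y : EuclideanSpace ℝ (Fin (d + 1))) p →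
      c ^ 2 + 2 * η * s.card ≤ (x : EuclideanSpace ℝ (Fin (d + 1))) p ^ 2 → r x y := by
  induction s using Finset.induction_on with
  | empty =>
    refine ⟨Eq, by simpa using Controlled.eq, fun x y hxy _ hp _ => ?_⟩
    have hxy' : ∀ i, i ≠ p →
        (x : EuclideanSpace ℝ (Fin (d + 1))) i = (y : EuclideanSpace ℝ (Fin (d + 1))) i :=
      fun i hi => hxy i (Finset.notMem_empty i) hi
    have h1 := (sum_sq_coord x).trans (sum_sq_coord y).symm
    rw [← Finset.add_sum_erase _ _ (Finset.mem_univ p),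
      ← Finset.add_sum_erase (f := fun i => (y : EuclideanSpace ℝ (Fin (d + 1))) i ^ 2) _
        (Finset.mem_univ p), Finset.sum_congr rfl fun i hi => by
        rw [hxy' i (Finset.ne_of_mem_erase hi)], add_left_inj] at h1
    refine Subtype.ext (PiLp.ext fun i => ?_)
    by_cases hi : i = p
    · subst hi
      rcases sq_eq_sq_iff_eq_or_eq_neg.mp h1 with h | h
      · exact h
      · rw [h] at hp
        nlinarith [sq_nonneg ((y : EuclideanSpace ℝ (Fin (d + 1))) i)]
    · exact hxy' i hi
  | insert i s his ih =>
    have hip : i ≠ p := fun h => hps (h ▸ Finset.mem_insert_self _ _)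
    obtain ⟨r, hr, hrel⟩ := ih fun h => hps (Finset.mem_insert_of_mem h)
    refine ⟨_, ((hκ i hip).comp hκ0 hr).mono (le_of_eq ?_) fun _ _ h => h, fun x y h1 h2 h3 h4 => ?_⟩
    · rw [Finset.card_insert_of_notMem his]; ring
    · rw [Finset.card_insert_of_notMem his] at h4
      push_cast at h4
      have hsη : 0 ≤ 2 * η * s.card := by positivity
      obtain ⟨w, hw, hwi, hwj, hwp, hwp2⟩ := exists_smallRot hip hc hc1 x
        (abs_coord_le_one y i) (h2 i hip) (by linarith)
      refine ⟨w, hw, hrel w y (fun j hj hjp => ?_) (fun j hj => ?_) ?_ (by linarith)⟩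
      · by_cases hji : j = i
        · rw [hji, hwi]
        · rw [hwj j hji hjp, h1 j (by simp [hji, hj]) hjp]
      · by_cases hji : j = i
        · rw [hji, hwi, sub_self, abs_zero]; exact hη
        · rw [hwj j hji hj]; exact h2 j hj
      · have := mul_pos hwp h3
        have hx2 : 0 < (x : EuclideanSpace ℝ (Fin (d + 1))) p ^ 2 := by nlinarith
        refine (pos_iff_pos_of_mul_pos ?_).mp hx2
        linarith

/-- The relation of being at distance at most `ε / (L + 1)` is controlled, with a small constant
if `ε` is small. -/
theorem exists_controlled_close (d : ℕ) (q : ℝ≥0∞) [Fact (1 ≤ q)] {η : ℝ} (hη : 0 < η) :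
    ∃ ε : ℝ, 0 < ε ∧ ∀ L : ℕ,
      Controlled (d := d) q L η fun x y => geodesicDist x y ≤ ε / (L + 1) := by
  set n : ℝ := (d : ℝ) + 1 with hn
  have hn1 : 1 ≤ n := by rw [hn]; linarith [(Nat.cast_nonneg d : (0 : ℝ) ≤ d)]
  -- 6n is 3 / c² for the choice c² = 1/(2n) made below.
  set K : ℝ := (1 + 2 * Real.exp 2) * (6 * n) with hK
  -- In order: the final constant, with one pivot relation for each of the n coordinates; the
  -- smallness required of a rotation; and room for the pivot, 2θn ≤ 1/(2n).
  have hev : ∀ᶠ ε : ℝ in nhdsWithin 0 (Set.Ioi 0), n * ((1 + K * ε) ^ d - 1) < η ∧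
      6 * n * ε < 1 / 2 ∧ 4 * n ^ 2 * ε < 1 := by
    refine Filter.Eventually.filter_mono nhdsWithin_le_nhds ?_
    have h1 : Tendsto (fun ε : ℝ => n * ((1 + K * ε) ^ d - 1)) (nhds 0) (nhds 0) := by
      have : Continuous fun ε : ℝ => n * ((1 + K * ε) ^ d - 1) := by fun_prop
      simpa using this.tendsto 0
    have h2 : Tendsto (fun ε : ℝ => 6 * n * ε) (nhds 0) (nhds 0) := by
      have : Continuous fun ε : ℝ => 6 * n * ε := by fun_prop
      simpa using this.tendsto 0
    have h3 : Tendsto (fun ε : ℝ => 4 * n ^ 2 * ε) (nhds 0) (nhds 0) := by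
      have : Continuous fun ε : ℝ => 4 * n ^ 2 * ε := by fun_prop
      simpa using this.tendsto 0
    exact (h1.eventually_lt_const hη).and
      ((h2.eventually_lt_const (by norm_num)).and (h3.eventually_lt_const one_pos))
  obtain ⟨ε, ⟨hε1, hε2, hε3⟩, hε0⟩ := (hev.and self_mem_nhdsWithin).exists
  refine ⟨ε, hε0, fun L => ?_⟩
  have hL : (1 : ℝ) ≤ L + 1 := by linarith [(Nat.cast_nonneg L : (0 : ℝ) ≤ L)]
  set θ : ℝ := ε / (L + 1) with hθ
  have hθ0 : 0 ≤ θ := by positivity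
  have hθε : θ ≤ ε := div_le_self hε0.le hL
  set c : ℝ := Real.sqrt (1 / (2 * n)) with hcdef
  have hc2 : c ^ 2 = 1 / (2 * n) := Real.sq_sqrt (by positivity)
  have hc : 0 < c := Real.sqrt_pos.mpr (by positivity)
  have hc1 : c ≤ 1 := by
    rw [hcdef, Real.sqrt_le_one, div_le_one (by positivity)]; linarith
  have hκ : ∀ p i : Fin (d + 1), i ≠ p →
      Controlled q L (K * ε) (SmallRot i p (3 * θ / c ^ 2)) := by
    intro p i hip
    have h := controlled_smallRot q hip L (ε := 6 * n * ε) (by positivity) hε2.le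
    have e1 : 3 * θ / c ^ 2 = 6 * n * ε / (L + 1) := by
      rw [hc2, hθ]; field_simp; ring
    rw [e1, hK, mul_assoc]
    exact h
  choose r hr hrel using fun p : Fin (d + 1) => exists_controlled_pivot hc hc1 hθ0
    (by positivity : 0 ≤ K * ε) (hκ p) (Finset.univ.erase p) (Finset.notMem_erase _ _)
  refine (Controlled.iUnion hr).mono ?_ ?_
  · simp only [Finset.mem_univ, Finset.card_erase_of_mem, Finset.card_univ, Fintype.card_fin,
      add_tsub_cancel_right, Finset.sum_const, nsmul_eq_mul]
    push_cast
    exact hε1.le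
  · intro x y hxy
    have hcoord : ∀ i, |(x : EuclideanSpace ℝ (Fin (d + 1))) i -
        (y : EuclideanSpace ℝ (Fin (d + 1))) i| ≤ θ :=
      fun i => (abs_coord_sub_le_geodesicDist x y i).trans hxy
    -- Some squared coordinate reaches the average 1/n. This pivot depends on x, which is why the
    -- union over p is taken.
    obtain ⟨p, -, hp⟩ : ∃ p ∈ (Finset.univ : Finset (Fin (d + 1))),
        1 / n ≤ (x : EuclideanSpace ℝ (Fin (d + 1))) p ^ 2 := by
      apply Finset.exists_le_of_sum_le Finset.univ_nonempty
      rw [sum_sq_coord x]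
      simp only [Finset.sum_const, Finset.card_univ, Fintype.card_fin, nsmul_eq_mul]
      push_cast
      rw [mul_one_div, ← hn, div_self (by positivity)]
    have hsmall : 2 * θ * n ≤ 1 / (2 * n) := by
      rw [le_div_iff₀ (by positivity)]
      nlinarith
    have h1n : 1 / n = 1 / (2 * n) + 1 / (2 * n) := by field_simp; ring
    refine ⟨p, hrel p x y (fun i hi hip => absurd hi (by simp [hip])) (fun i _ => hcoord i) ?_ ?_⟩
    · have h1 := abs_le.mp (hcoord p)
      have h2 : θ ^ 2 < (x : EuclideanSpace ℝ (Fin (d + 1))) p ^ 2 := by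
        have hθ1 : θ ≤ 1 := by nlinarith
        have : θ ^ 2 ≤ 2 * θ * n := by nlinarith
        have : 0 < 1 / (2 * n) := by positivity
        linarith
      have h3 := sq_lt_sq.mp h2
      rw [abs_of_nonneg hθ0] at h3
      rcases lt_or_ge 0 ((x : EuclideanSpace ℝ (Fin (d + 1))) p) with h | h
      · rw [abs_of_pos h] at h3
        exact mul_pos h (by linarith)
      · rw [abs_of_nonpos h] at h3
        exact mul_pos_of_neg_of_neg (by linarith) (by linarith)
    · rw [Finset.card_erase_of_mem (Finset.mem_univ _), Finset.card_univ, Fintype.card_fin,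
        add_tsub_cancel_right, hc2]
      have : 2 * θ * d ≤ 2 * θ * n := by gcongr; linarith
      linarith

/-! ### Discrete `ℓ^p` norms -/

section SampNorm

variable {ι κ : Type*} [Fintype ι] [Fintype κ] {p : ℝ≥0∞}

/-- The `ℓ^p` norm of a finite family of complex numbers. -/
noncomputable def sampNorm (p : ℝ≥0∞) (v : ι → ℂ) : ℝ :=
  ‖(WithLp.toLp p v : PiLp p fun _ : ι => ℂ)‖

lemma sampNorm_top (v : ι → ℂ) : sampNorm ∞ v = ⨆ j, ‖v j‖ := rfl

lemma sampNorm_eq (hp : 0 < p.toReal) (v : ι → ℂ) :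
    sampNorm p v = (∑ j, ‖v j‖ ^ p.toReal) ^ p.toReal⁻¹ := by
  rw [sampNorm, PiLp.norm_eq_sum hp, one_div]

lemma sampNorm_rpow (hp : 0 < p.toReal) (v : ι → ℂ) :
    sampNorm p v ^ p.toReal = ∑ j, ‖v j‖ ^ p.toReal := by
  rw [sampNorm_eq hp, Real.rpow_inv_rpow (Finset.sum_nonneg fun j _ => by positivity) hp.ne']

variable [Fact (1 ≤ p)]

lemma toReal_pos_of_ne_top (hp : p ≠ ∞) : 0 < p.toReal :=
  ENNReal.toReal_pos (zero_lt_one.trans_le Fact.out).ne' hp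

lemma sampNorm_nonneg (v : ι → ℂ) : 0 ≤ sampNorm p v := norm_nonneg _

lemma sampNorm_zero : sampNorm p (0 : ι → ℂ) = 0 := norm_zero

lemma sampNorm_add_le (v w : ι → ℂ) : sampNorm p (v + w) ≤ sampNorm p v + sampNorm p w :=
  norm_add_le (WithLp.toLp p v : PiLp p fun _ : ι => ℂ) (WithLp.toLp p w)

/-- Comparison of `ℓ^p` norms along a map with fibres of bounded cardinality. -/
lemma sampNorm_le_of_fiber_le [DecidableEq κ] {v : ι → ℂ} {w : κ → ℂ} {K : ℝ} (hK : 0 ≤ K)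
    (φ : ι → κ) (hφ : p ≠ ∞ → ∀ k, ((Finset.univ.filter fun j => φ j = k).card : ℝ) ≤ K)
    (h : ∀ j, ‖v j‖ ≤ ‖w (φ j)‖) :
    sampNorm p v ≤ K ^ p.toReal⁻¹ * sampNorm p w := by
  by_cases hp : p = ∞
  · subst hp
    -- At p = ∞ the exponent `p.toReal⁻¹` is 0, so the factor is 1 and fibre sizes play no role.
    rw [ENNReal.toReal_top, inv_zero, Real.rpow_zero, one_mul, sampNorm_top, sampNorm_top]
    refine Real.iSup_le (fun j => (h j).trans ?_) (Real.iSup_nonneg fun k => norm_nonneg _)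
    exact le_ciSup (f := fun k => ‖w k‖) (Set.finite_range _).bddAbove (φ j)
  · have hp0 := toReal_pos_of_ne_top hp
    rw [sampNorm_eq hp0, sampNorm_eq hp0, ← Real.mul_rpow hK
      (Finset.sum_nonneg fun j _ => by positivity)]
    refine Real.rpow_le_rpow (Finset.sum_nonneg fun j _ => by positivity) ?_ (by positivity)
    calc ∑ j, ‖v j‖ ^ p.toReal ≤ ∑ j, ‖w (φ j)‖ ^ p.toReal := by
          gcongr with j
          exact h j
      _ = ∑ k, ∑ j with φ j = k, ‖w (φ j)‖ ^ p.toReal := (Finset.sum_fiberwise _ _ _).symm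
      _ = ∑ k, ((Finset.univ.filter fun j => φ j = k).card : ℝ) * ‖w k‖ ^ p.toReal := by
          refine Finset.sum_congr rfl fun k _ => ?_
          rw [← nsmul_eq_mul, ← Finset.sum_const]
          refine Finset.sum_congr rfl fun j hj => ?_
          rw [(Finset.mem_filter.mp hj).2]
      _ ≤ ∑ k, K * ‖w k‖ ^ p.toReal := by
          gcongr with k
          exact hφ hp k
      _ = K * ∑ k, ‖w k‖ ^ p.toReal := by rw [Finset.mul_sum]

lemma sampNorm_le_of_injective {v : ι → ℂ} {w : κ → ℂ} {φ : ι → κ} (hφ : Function.Injective φ)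
    (h : ∀ j, ‖v j‖ ≤ ‖w (φ j)‖) : sampNorm p v ≤ sampNorm p w := by
  classical
  have := sampNorm_le_of_fiber_le (p := p) zero_le_one φ (fun _ k => ?_) h
  · rwa [Real.one_rpow, one_mul] at this
  · rw [Nat.cast_le_one, Finset.card_le_one]
    intro a ha b hb
    simp only [Finset.mem_filter] at ha hb
    exact hφ (ha.2.trans hb.2.symm)

lemma sampNorm_mono {v w : ι → ℂ} (h : ∀ j, ‖v j‖ ≤ ‖w j‖) : sampNorm p v ≤ sampNorm p w :=
  sampNorm_le_of_injective Function.injective_id h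

lemma sampNorm_le_sum {α : Type*} [Fintype α] {v : ι → ℂ} (g : α → ι → ℂ)
    (h : ∀ j, ‖v j‖ ≤ ∑ i, ‖g i j‖) : sampNorm p v ≤ ∑ i, sampNorm p (g i) := by
  let u : α → ι → ℂ := fun i j => (‖g i j‖ : ℂ)
  calc sampNorm p v ≤ sampNorm p (∑ i, u i) := by
        refine sampNorm_mono fun j => (h j).trans (le_of_eq ?_)
        rw [Finset.sum_apply, ← Complex.ofReal_sum, Complex.norm_real,
          Real.norm_of_nonneg (Finset.sum_nonneg fun i _ => norm_nonneg _)]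
    _ ≤ ∑ i, sampNorm p (u i) := by
        rw [sampNorm, WithLp.toLp_sum]
        exact norm_sum_le _ _
    _ ≤ ∑ i, sampNorm p (g i) := by
        gcongr with i
        exact sampNorm_mono fun j => by simp [u]

end SampNorm

/-! ### Unified form of the Marcinkiewicz-Zygmund inequalities -/

section Norms

variable {p : ℝ≥0∞} {f : Sph d → ℂ}

lemma memLp_of_continuous (p : ℝ≥0∞) (hf : Continuous f) : MemLp f p (surfaceMeasure d) := by
  obtain ⟨C, hC⟩ := (isCompact_range hf.norm).bddAbove
  exact MemLp.of_bound hf.aestronglyMeasurable C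
    (Eventually.of_forall fun x => hC (Set.mem_range_self x))

lemma lpNormSph_rpow (hp : 0 < p.toReal) (hf : Continuous f) :
    lpNormSph p f ^ p.toReal = ∫ x, ‖f x‖ ^ p.toReal ∂(surfaceMeasure d) := by
  have h := ENNReal.toReal_pos_iff.mp hp
  have hint : 0 ≤ ∫ x, ‖f x‖ ^ p.toReal ∂(surfaceMeasure d) :=
    integral_nonneg fun x => by positivity
  rw [lpNormSph, (memLp_of_continuous p hf).eLpNorm_eq_integral_rpow_norm h.1.ne' h.2.ne,
    ENNReal.toReal_ofReal (by positivity), Real.rpow_inv_rpow hint hp.ne']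

/-- The bound holds almost everywhere on a closed set, which is then everything because nonempty
open sets have positive measure. -/
lemma norm_le_lpNormSph_top (hf : Continuous f) (x : Sph d) : ‖f x‖ ≤ lpNormSph ∞ f := by
  have hfin := (memLp_of_continuous ∞ hf).eLpNorm_ne_top
  have hae : ∀ᵐ y ∂(surfaceMeasure d), ‖f y‖ ≤ lpNormSph ∞ f := by
    have h := ae_le_eLpNormEssSup (f := f) (μ := surfaceMeasure d)
    filter_upwards [h] with y hy
    rw [← eLpNorm_exponent_top] at hy
    rw [← toReal_enorm, lpNormSph]
    exact ENNReal.toReal_mono hfin hy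
  have hclosed : IsClosed {y | ‖f y‖ ≤ lpNormSph ∞ f} := isClosed_le hf.norm continuous_const
  have huniv : {y | ‖f y‖ ≤ lpNormSph ∞ f} = Set.univ :=
    (hclosed.ae_eq_univ_iff_eq (μ := surfaceMeasure d)).mp (eventuallyEq_univ.mpr hae)
  exact Set.eq_univ_iff_forall.mp huniv x

lemma lpNormSph_top (hf : Continuous f) : lpNormSph ∞ f = ⨆ x, ‖f x‖ := by
  refine le_antisymm ?_ (ciSup_le fun x => norm_le_lpNormSph_top hf x)
  have hbdd := (isCompact_range hf.norm).bddAbove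
  rw [lpNormSph, eLpNorm_exponent_top]
  refine ENNReal.toReal_le_of_le_ofReal (Real.iSup_nonneg fun x => norm_nonneg _) ?_
  exact eLpNormEssSup_le_of_ae_bound (Eventually.of_forall fun x => le_ciSup hbdd x)

lemma eq_zero_of_lpNormSph_eq_zero (hp : p ≠ 0) (hf : Continuous f) (h : lpNormSph p f = 0) :
    f = 0 := by
  rw [lpNormSph, ENNReal.toReal_eq_zero_iff] at h
  have h0 := h.resolve_right (memLp_of_continuous p hf).eLpNorm_ne_top
  rw [eLpNorm_eq_zero_iff hf.aestronglyMeasurable hp] at h0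
  exact (Continuous.ae_eq_iff_eq (surfaceMeasure d) hf continuous_const).mp h0

end Norms

namespace TriangularFamily

/-- The Marcinkiewicz-Zygmund inequalities in a form which is uniform in `p`. -/
def MZBound (p : ℝ≥0∞) (Z : TriangularFamily d) (A : ℝ) : Prop :=
  ∀ L : ℕ, ∀ f ∈ harmonicsUpTo d L,
    sampNorm p (fun j => f (Z.point L j)) ≤
      A * ((dimUpTo d L : ℝ) ^ p.toReal⁻¹ * lpNormSph p f) ∧
    (dimUpTo d L : ℝ) ^ p.toReal⁻¹ * lpNormSph p f ≤
      A * sampNorm p (fun j => f (Z.point L j))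

lemma IsMZ.exists_mzBound {p : ℝ≥0∞} [Fact (1 ≤ p)] (hd : 1 ≤ d) {Z : TriangularFamily d}
    (hZ : Z.IsMZ p) : ∃ A : ℝ, 0 < A ∧ Z.MZBound p A := by
  by_cases hp : p = ∞
  · obtain ⟨C, hC, h⟩ := hZ.2.2 hp
    subst hp
    -- For p = ∞ the weight π_L^0 is 1, and the upper sampling bound holds trivially with constant
    -- 1.
    refine ⟨max C 1, by positivity, fun L f hf => ?_⟩
    have hfc := continuous_of_mem_harmonicsUpTo hf
    have hS := sampNorm_nonneg (p := ∞) fun j => f (Z.point L j)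
    rw [ENNReal.toReal_top, inv_zero, Real.rpow_zero, one_mul]
    constructor
    · refine le_trans ?_ (le_mul_of_one_le_left (lpNormSph_nonneg _ _) (le_max_right _ _))
      exact Real.iSup_le (fun j => norm_le_lpNormSph_top hfc _) (lpNormSph_nonneg _ _)
    · rw [lpNormSph_top hfc]
      exact (h L f hf).trans (mul_le_mul_of_nonneg_right (le_max_left _ _) hS)
  · obtain ⟨C, hC, h⟩ := hZ.2.1 hp
    have hp0 := toReal_pos_of_ne_top hp
    refine ⟨C ^ p.toReal⁻¹, by positivity, fun L f hf => ?_⟩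
    have hπ : (0 : ℝ) < dimUpTo d L := by
      exact_mod_cast (Nat.succ_pos L).trans_le (succ_le_dimUpTo hd L)
    have hS := sampNorm_nonneg (p := p) fun j => f (Z.point L j)
    have hN := lpNormSph_nonneg p f
    obtain ⟨h1, h2⟩ := h L f hf
    rw [← lpNormSph_rpow hp0 (continuous_of_mem_harmonicsUpTo hf),
      ← sampNorm_rpow hp0 fun j => f (Z.point L j)] at h1 h2
    constructor
    · rw [← Real.rpow_le_rpow_iff hS (by positivity) hp0, Real.mul_rpow (by positivity)
        (by positivity), Real.mul_rpow (by positivity) hN, Real.rpow_inv_rpow hC.le hp0.ne',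
        Real.rpow_inv_rpow hπ.le hp0.ne']
      rwa [div_mul_eq_mul_div, div_le_iff₀ hπ, inv_mul_le_iff₀ hC, mul_comm _ (dimUpTo d L : ℝ)]
        at h1
    · rw [← Real.rpow_le_rpow_iff (by positivity) (by positivity) hp0, Real.mul_rpow
        (by positivity) hN, Real.mul_rpow (by positivity) hS, Real.rpow_inv_rpow hC.le hp0.ne',
        Real.rpow_inv_rpow hπ.le hp0.ne']
      rwa [div_mul_eq_mul_div, le_div_iff₀ hπ, mul_comm] at h2

lemma MZBound.isMZ {p : ℝ≥0∞} [Fact (1 ≤ p)] (hd : 1 ≤ d) {Z : TriangularFamily d} {A : ℝ}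
    (hA : 0 < A) (h : Z.MZBound p A) (hm : ∀ L, dimUpTo d L ≤ Z.m L) : Z.IsMZ p := by
  refine ⟨hm, fun hp => ?_, fun hp => ?_⟩
  · have hp0 := toReal_pos_of_ne_top hp
    refine ⟨A ^ p.toReal, by positivity, fun L f hf => ?_⟩
    have hπ : (0 : ℝ) < dimUpTo d L := by
      exact_mod_cast (Nat.succ_pos L).trans_le (succ_le_dimUpTo hd L)
    have hS := sampNorm_nonneg (p := p) fun j => f (Z.point L j)
    have hN := lpNormSph_nonneg p f
    obtain ⟨h1, h2⟩ := h L f hf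
    rw [← lpNormSph_rpow hp0 (continuous_of_mem_harmonicsUpTo hf),
      ← sampNorm_rpow hp0 fun j => f (Z.point L j)]
    constructor
    · rw [← Real.rpow_le_rpow_iff hS (by positivity) hp0, Real.mul_rpow (by positivity)
        (by positivity), Real.mul_rpow (by positivity) hN, Real.rpow_inv_rpow hπ.le hp0.ne'] at h1
      rwa [div_mul_eq_mul_div, div_le_iff₀ hπ, inv_mul_le_iff₀ (by positivity),
        mul_comm _ (dimUpTo d L : ℝ)]
    · rw [← Real.rpow_le_rpow_iff (by positivity) (by positivity) hp0, Real.mul_rpow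
        (by positivity) hN, Real.mul_rpow (by positivity) hS,
        Real.rpow_inv_rpow hπ.le hp0.ne'] at h2
      rwa [div_mul_eq_mul_div, le_div_iff₀ hπ, mul_comm]
  · subst hp
    refine ⟨A, hA, fun L f hf => ?_⟩
    have h2 := (h L f hf).2
    rwa [ENNReal.toReal_top, inv_zero, Real.rpow_zero, one_mul,
      lpNormSph_top (continuous_of_mem_harmonicsUpTo hf)] at h2

end TriangularFamily

/-! ### Selection of a separated subfamily -/

lemma geodesicDist_self (x : Sph d) : geodesicDist x x = 0 := by
  rw [geodesicDist, real_inner_self_eq_norm_sq]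
  simp

lemma geodesicDist_comm (x y : Sph d) : geodesicDist x y = geodesicDist y x := by
  rw [geodesicDist, geodesicDist, real_inner_comm]

/-- A maximal separated set of indices: an index farther than δ from all of it could be added.
Working with indices rather than points also handles repetitions. -/
lemma exists_separated_subset {m : ℕ} (z : Fin m → Sph d) {δ : ℝ} (hδ : 0 ≤ δ) :
    ∃ (n : ℕ) (e : Fin n ↪ Fin m) (φ : Fin m → Fin n),
      (∀ j k, j ≠ k → δ ≤ geodesicDist (z (e j)) (z (e k))) ∧
      ∀ j, geodesicDist (z j) (z (e (φ j))) ≤ δ := by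
  classical
  let P : Finset (Fin m) → Prop := fun J =>
    ∀ j ∈ J, ∀ k ∈ J, j ≠ k → δ ≤ geodesicDist (z j) (z k)
  obtain ⟨J, hJ⟩ := (Set.toFinite {J | P J}).exists_maximal
    ⟨∅, fun j hj => absurd hj (Finset.notMem_empty j)⟩
  have hclose : ∀ j, ∃ k : J, geodesicDist (z j) (z k) ≤ δ := by
    intro j
    by_contra! hcon
    have hjJ : j ∉ J := fun hj => by
      have := hcon ⟨j, hj⟩
      rw [geodesicDist_self] at this
      linarith
    refine hjJ (hJ.2 (y := insert j J) ?_ (Finset.subset_insert _ _) (Finset.mem_insert_self _ _))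
    intro a ha b hb hab
    rcases Finset.mem_insert.mp ha with rfl | ha' <;> rcases Finset.mem_insert.mp hb with rfl | hb'
    · exact absurd rfl hab
    · exact (hcon ⟨b, hb'⟩).le
    · rw [geodesicDist_comm]; exact (hcon ⟨a, ha'⟩).le
    · exact hJ.1 a ha' b hb' hab
  choose φ hφ using hclose
  refine ⟨J.card, J.equivFin.symm.toEmbedding.trans (Function.Embedding.subtype _),
    fun j => J.equivFin (φ j), fun j k hjk => hJ.1 _ (J.equivFin.symm j).2 _
      (J.equivFin.symm k).2 fun h => hjk (J.equivFin.symm.injective (Subtype.ext h)), fun j => ?_⟩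
  simpa using hφ j

end SphereMZ

/-! ### Thinning a Marcinkiewicz-Zygmund family -/

open SphereMZ in
theorem mainTheorem4 (d : ℕ) (hd : 1 ≤ d) (p : ℝ≥0∞) (hp : 1 ≤ p)
    (Z : SphereMZ.TriangularFamily d) (hZ : Z.IsMZ p) :
    ∃ Z' : SphereMZ.TriangularFamily d,
      Z'.IsSubfamily Z ∧ Z'.UniformlySeparated ∧ Z'.IsMZ p := by
  have : Fact (1 ≤ p) := ⟨hp⟩
  obtain ⟨A, hA, hbound⟩ := hZ.exists_mzBound hd
  -- A² η ≤ 1/2 lets the perturbation be absorbed in the lower bound; η ≤ 1 gives (1 + η) A ≤ 2A in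
  -- the upper one.
  set η : ℝ := min 1 (1 / (2 * A ^ 2)) with hη
  have hη0 : 0 < η := by positivity
  have hη1 : η ≤ 1 := min_le_left _ _
  have hηA : A ^ 2 * η ≤ 1 / 2 := by
    calc A ^ 2 * η ≤ A ^ 2 * (1 / (2 * A ^ 2)) := by gcongr; exact min_le_right _ _
      _ = 1 / 2 := by field_simp
  obtain ⟨ε, hε, hctl⟩ := exists_controlled_close d p hη0
  obtain ⟨c, hc, htest⟩ := exists_concentrated d
  choose n e φ hsep hφ using fun L : ℕ =>
    exists_separated_subset (Z.point L) (δ := ε / (L + 1)) (by positivity)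
  have hπ : ∀ L, (0 : ℝ) < dimUpTo d L := fun L => by
    exact_mod_cast (Nat.succ_pos L).trans_le (succ_le_dimUpTo hd L)
  -- replacing every point by the selected one changes the `ℓ^p` norms only a little
  have hpert : ∀ L, ∀ f ∈ harmonicsUpTo d L,
      sampNorm p (fun j => f (Z.point L (e L (φ L j))) - f (Z.point L j)) ≤
        A * ((dimUpTo d L : ℝ) ^ p.toReal⁻¹ * (η * lpNormSph p f)) := by
    intro L f hf
    obtain ⟨ι, _, g, hg, hle, hsum⟩ := hctl L f hf
    calc _ ≤ ∑ i, sampNorm p fun j => g i (Z.point L j) :=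
          sampNorm_le_sum (fun i j => g i (Z.point L j)) fun j => hle _ _ (hφ L j)
      _ ≤ ∑ i, A * ((dimUpTo d L : ℝ) ^ p.toReal⁻¹ * lpNormSph p (g i)) :=
          Finset.sum_le_sum fun i _ => (hbound L _ (hg i)).1
      _ = A * ((dimUpTo d L : ℝ) ^ p.toReal⁻¹ * ∑ i, lpNormSph p (g i)) := by
          rw [← Finset.mul_sum, ← Finset.mul_sum]
      _ ≤ _ := by gcongr
  have hrep : ∀ L, ∀ f ∈ harmonicsUpTo d L, (dimUpTo d L : ℝ) ^ p.toReal⁻¹ * lpNormSph p f ≤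
      2 * A * sampNorm p (fun j => f (Z.point L (e L (φ L j)))) := by
    intro L f hf
    have h1 := (hbound L f hf).2
    have h2 := hpert L f hf
    have h3 : sampNorm p (fun j => f (Z.point L j)) ≤
        sampNorm p (fun j => f (Z.point L (e L (φ L j)))) +
          sampNorm p (fun j => f (Z.point L (e L (φ L j))) - f (Z.point L j)) := by
      refine (sampNorm_le_sum (α := Fin 2) ![fun j => f (Z.point L (e L (φ L j))),
        fun j => f (Z.point L (e L (φ L j))) - f (Z.point L j)] fun j => ?_).trans (by simp)
      rw [Fin.sum_univ_two]
      refine le_trans (le_of_eq ?_) (norm_sub_le _ _)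
      simp
    have hX : 0 ≤ (dimUpTo d L : ℝ) ^ p.toReal⁻¹ * lpNormSph p f :=
      mul_nonneg (by positivity) (lpNormSph_nonneg _ _)
    have h4 : A * (A * ((dimUpTo d L : ℝ) ^ p.toReal⁻¹ * (η * lpNormSph p f))) ≤
        1 / 2 * ((dimUpTo d L : ℝ) ^ p.toReal⁻¹ * lpNormSph p f) := by
      calc _ = A ^ 2 * η * ((dimUpTo d L : ℝ) ^ p.toReal⁻¹ * lpNormSph p f) := by ring
        _ ≤ _ := by gcongr
    -- With X = π_L^(1/p) ‖f‖_p and S the perturbed sample norm, X ≤ A S + A² η X ≤ A S + X/2.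
    have h5 := mul_le_mul_of_nonneg_left (h3.trans (add_le_add le_rfl h2)) hA.le
    linarith
  -- the number of points close to a selected one is bounded
  set K : ℝ := (2 * A) ^ p.toReal / c with hK
  have hK0 : 0 < K := by positivity
  have hfib : p ≠ ∞ → ∀ L k, ((Finset.univ.filter fun j => φ L j = k).card : ℝ) ≤ K := by
    intro hp' L k
    have hp0 := toReal_pos_of_ne_top hp'
    have hp1 : 1 ≤ p.toReal := by
      rw [← ENNReal.toReal_one]; exact ENNReal.toReal_mono hp' hp
    set x := Z.point L (e L k) with hx
    obtain ⟨f, hf, hfint, hfpos⟩ := htest L x p.toReal hp1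
    have hfx : 0 < ‖f x‖ := hfpos (by exact_mod_cast hπ L)
    rw [← lpNormSph_rpow hp0 (continuous_of_mem_harmonicsUpTo hf)] at hfint
    have hN := lpNormSph_nonneg p f
    have h1 : sampNorm p (fun j => f (Z.point L (e L (φ L j)))) ≤
        2 * A * ((dimUpTo d L : ℝ) ^ p.toReal⁻¹ * lpNormSph p f) := by
      have h2 := (hbound L f hf).1
      have h3 := hpert L f hf
      have h4 := sampNorm_add_le (p := p) (fun j => f (Z.point L j))
        fun j => f (Z.point L (e L (φ L j))) - f (Z.point L j)
      have h5 : (fun j => f (Z.point L j)) +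
          (fun j => f (Z.point L (e L (φ L j))) - f (Z.point L j)) =
          fun j => f (Z.point L (e L (φ L j))) := by ext j; simp
      rw [h5] at h4
      have h6 : A * ((dimUpTo d L : ℝ) ^ p.toReal⁻¹ * (η * lpNormSph p f)) ≤
          A * ((dimUpTo d L : ℝ) ^ p.toReal⁻¹ * (1 * lpNormSph p f)) := by gcongr
      rw [one_mul] at h6
      linarith
    -- Every index in the fibre over k contributes the same value |f(x)|^p to the perturbed sum.
    have h2 : ((Finset.univ.filter fun j => φ L j = k).card : ℝ) * ‖f x‖ ^ p.toReal ≤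
        (2 * A) ^ p.toReal * (dimUpTo d L * lpNormSph p f ^ p.toReal) := by
      calc _ = ∑ j with φ L j = k, ‖f (Z.point L (e L (φ L j)))‖ ^ p.toReal := by
            rw [← nsmul_eq_mul, ← Finset.sum_const]
            exact Finset.sum_congr rfl fun j hj => by rw [(Finset.mem_filter.mp hj).2]
        _ ≤ ∑ j, ‖f (Z.point L (e L (φ L j)))‖ ^ p.toReal :=
            Finset.sum_le_sum_of_subset_of_nonneg (Finset.filter_subset _ _)
              fun _ _ _ => by positivity
        _ = sampNorm p (fun j => f (Z.point L (e L (φ L j)))) ^ p.toReal :=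
            (sampNorm_rpow hp0 _).symm
        _ ≤ (2 * A * ((dimUpTo d L : ℝ) ^ p.toReal⁻¹ * lpNormSph p f)) ^ p.toReal :=
            Real.rpow_le_rpow (sampNorm_nonneg _) h1 hp0.le
        _ = _ := by
            rw [Real.mul_rpow (by positivity) (by positivity), Real.mul_rpow (by positivity) hN,
              Real.rpow_inv_rpow (hπ L).le hp0.ne']
    have h3 : ((Finset.univ.filter fun j => φ L j = k).card : ℝ) * ‖f x‖ ^ p.toReal ≤
        K * ‖f x‖ ^ p.toReal := by
      calc _ ≤ (2 * A) ^ p.toReal * (dimUpTo d L * lpNormSph p f ^ p.toReal) := h2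
        _ = K * (c * dimUpTo d L * lpNormSph p f ^ p.toReal) := by rw [hK]; field_simp
        _ ≤ _ := by gcongr
    exact le_of_mul_le_mul_right h3 (by positivity)
  have hlow : ∀ L, ∀ f ∈ harmonicsUpTo d L, (dimUpTo d L : ℝ) ^ p.toReal⁻¹ * lpNormSph p f ≤
      2 * A * K ^ p.toReal⁻¹ * sampNorm p (fun j => f (Z.point L (e L j))) := by
    intro L f hf
    have h := sampNorm_le_of_fiber_le (p := p) (v := fun j => f (Z.point L (e L (φ L j))))
      (w := fun j => f (Z.point L (e L j))) hK0.le (φ L) (fun hp' k => hfib hp' L k)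
      fun j => le_rfl
    calc _ ≤ _ := hrep L f hf
      _ ≤ 2 * A * (K ^ p.toReal⁻¹ * sampNorm p (fun j => f (Z.point L (e L j)))) := by gcongr
      _ = _ := by ring
  -- By the lower inequality, a function of Π_L vanishing at the selected points is zero.
  have hdim : ∀ L, dimUpTo d L ≤ n L := by
    intro L
    let T : harmonicsUpTo d L →ₗ[ℂ] (Fin (n L) → ℂ) :=
      LinearMap.pi fun j => (LinearMap.proj (Z.point L (e L j))).comp (harmonicsUpTo d L).subtype
    have hT : Function.Injective T := by
      rw [injective_iff_map_eq_zero]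
      intro f hf
      have h := hlow L f.1 f.2
      have h0 : (fun j => f.1 (Z.point L (e L j))) = 0 := hf
      rw [h0, sampNorm_zero, mul_zero] at h
      have hpos : (0 : ℝ) < (dimUpTo d L : ℝ) ^ p.toReal⁻¹ := Real.rpow_pos_of_pos (hπ L) _
      have hN : lpNormSph p f.1 = 0 :=
        le_antisymm (nonpos_of_mul_nonpos_right h hpos) (lpNormSph_nonneg _ _)
      exact Subtype.ext (eq_zero_of_lpNormSph_eq_zero (zero_lt_one.trans_le hp).ne'
        (continuous_of_mem_harmonicsUpTo f.2) hN)
    simpa [dimUpTo] using LinearMap.finrank_le_finrank_of_injective hT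
  let Z' : TriangularFamily d :=
    { m := n
      point := fun L j => Z.point L (e L j)
      tendsto_m := tendsto_atTop_mono
        (fun L => (Nat.le_succ L).trans ((succ_le_dimUpTo hd L).trans (hdim L))) tendsto_id }
  refine ⟨Z', fun L => ⟨e L, fun j => rfl⟩, ⟨ε, hε, fun L j k hjk => hsep L j k hjk⟩, ?_⟩
  -- A suffices for the upper sampling bound, as points are only removed; the other constant is that
  -- of the lower bound.
  refine TriangularFamily.MZBound.isMZ hd (A := max A (2 * A * K ^ p.toReal⁻¹))
    (lt_max_of_lt_left hA) (fun L f hf => ⟨?_, ?_⟩) hdim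
  · calc sampNorm p (fun j => f (Z'.point L j)) ≤ sampNorm p (fun j => f (Z.point L j)) :=
          sampNorm_le_of_injective (e L).injective fun j => le_rfl
      _ ≤ A * ((dimUpTo d L : ℝ) ^ p.toReal⁻¹ * lpNormSph p f) := (hbound L f hf).1
      _ ≤ _ := mul_le_mul_of_nonneg_right (le_max_left _ _)
          (mul_nonneg (by positivity) (lpNormSph_nonneg _ _))
  · exact (hlow L f hf).trans (mul_le_mul_of_nonneg_right (le_max_right _ _) (sampNorm_nonneg _))
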